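/- Let $d\ge 1$ be an integer, $a<(d-2)/2$ and $\gamma\ge 1/4$. Let $\mathcal D^{1,2}_a(\mathbb R^d)$ be the completion, with respect to the norm $\big(\int_{\mathbb R^d}|\nabla u|^2\,|x|^{-2a}\,dx\big)^{1/2}$, of the space of smooth real functions with compact support in $\mathbb R^d\setminus\{0\}$ if $d\ge 2$, and of the space of smooth compactly supported functions $u$ on $\mathbb R$ with $u'(0)=0$ if $d=1$; by the weighted Hardy inequality its elements are functions in $L^2(\mathbb R^d,|x|^{-2(a+1)}dx)$ that have a generalized gradient $\nabla u$ in $L^2(\mathbb R^d,|x|^{-2a}dx)$. Put $$\mathsf C^*_{\rm GLH}=\frac1\gamma\,\frac{\Gamma(\frac d2)^{\frac1{2\gamma}}}{(8\,\pi^{d+1}e)^{\frac1{4\gamma}}}\left(\frac{4\gamma-1}{(d-2-2a)^2}\right)^{\frac{4\gamma-1}{4\gamma}}\ \text{ if }\gamma>\tfrac14,\qquad \mathsf C^*_{\rm GLH}=4\,\frac{\Gamma(\frac d2)^2}{8\,\pi^{d+1}e}\ \text{ if }\gamma=\tfrac14 .$$ (i) If $u=u(|x|)\in\mathcal D^{1,2}_a(\mathbb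 R^d)$ is radially symmetric and $\int_{\mathbb R^d}\frac{|u|^2}{|x|^{2(a+1)}}\,dx=1$, then $$\int_{\mathbb R^d}\frac{|u|^2}{|x|^{2(a+1)}}\,\log\left(|x|^{d-2-2a}|u|^2\right)dx\;\le\;2\gamma\,\log\left[\mathsf C^*_{\rm GLH}\int_{\mathbb R^d}\frac{|\nabla u|^2}{|x|^{2a}}\,dx\right],$$ where the positive part of the integrand on the left is integrable, so that the left-hand side is well defined in $[-\infty,\infty)$. (ii) The constant is sharp: if the inequality of (i) holds for all such $u$ with a constant $C>0$ in place of $\mathsf C^*_{\rm GLH}$, then $C\ge\mathsf C^*_{\rm GLH}$. (iii) If $\gamma>\frac14$, equality in (i) is achieved by the radial function $$u=\frac{\tilde u}{\left(\int_{\mathbb R^d}\frac{|\tilde u|^2}{|x|^{2(a+1)}}\,dx\right)^{1/2}},\qquad \tilde u(x)=|x|^{-\frac{d-2-2a}2}\,\exp\left(-\frac{(d-2-2a)^2}{4\,(4\gamma-1)}\,\big[\log|x|\big]^2\right),$$ which belongs to $\mathcal D^{1,2}_a(\mathbb R^d)$ and is normalized as in (i). -/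

import Mathlib

open MeasureTheory Filter Topology
open scoped ContDiff

noncomputable section

namespace LogHardy

/-- The space `ℝ^d` with its Euclidean norm and Lebesgue measure. -/
abbrev E (d : ℕ) : Type := EuclideanSpace ℝ (Fin d)

/-- The test functions whose completion is `𝒟^{1,2}_a(ℝ^d)`: smooth functions with compact
support in `ℝ^d ∖ {0}` if `d ≥ 2`, and smooth compactly supported functions on `ℝ` whose
derivative vanishes at the origin if `d = 1`. -/
structure IsTestFunction {d : ℕ} (φ : E d → ℝ) : Prop where
  contDiff : ContDiff ℝ ∞ φ
  hasCompactSupport : HasCompactSupport φ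
  zero_notMem_tsupport : 2 ≤ d → (0 : E d) ∉ tsupport φ
  gradient_zero : d = 1 → gradient φ 0 = 0

/-- `u` belongs to `𝒟^{1,2}_a(ℝ^d)` and has (generalized) gradient `G`: there are test functions
`φ n` with `∇ φ n → G` in `L²(|x|^{-2a} dx)` (that is, `φ n` is a Cauchy sequence for the norm
being completed and `G` is the limit of its gradients), the limit being identified with the
function `u` through the weighted Hardy inequality, that is, `φ n → u` in
`L²(|x|^{-2(a+1)} dx)`. -/
structure HasWeightedGradient {d : ℕ} (a : ℝ) (u : E d → ℝ) (G : E d → E d) : Prop where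
  aestronglyMeasurable : AEStronglyMeasurable u volume
  aestronglyMeasurable_gradient : AEStronglyMeasurable G volume
  exists_seq : ∃ φ : ℕ → E d → ℝ, (∀ n, IsTestFunction (φ n)) ∧
    Tendsto (fun n => ∫⁻ x, ENNReal.ofReal (‖gradient (φ n) x - G x‖ ^ 2 / ‖x‖ ^ (2 * a)))
      atTop (𝓝 0) ∧
    Tendsto (fun n => ∫⁻ x, ENNReal.ofReal ((φ n x - u x) ^ 2 / ‖x‖ ^ (2 * (a + 1))))
      atTop (𝓝 0)

/-- `u` is (almost everywhere) a function of `|x|` only. Measurability of the profile is no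
restriction for a measurable `u`. -/
def IsRadial {d : ℕ} (u : E d → ℝ) : Prop :=
  ∃ f : ℝ → ℝ, Measurable f ∧ ∀ᵐ x : E d, u x = f ‖x‖

/-- `∫ |u|² / |x|^{2(a+1)} dx`. -/
def weightedMass {d : ℕ} (a : ℝ) (u : E d → ℝ) : ℝ :=
  ∫ x, u x ^ 2 / ‖x‖ ^ (2 * (a + 1))

/-- `∫ |G|² / |x|^{2a} dx`, to be used with `G` the gradient of `u`. -/
def dirichletEnergy {d : ℕ} (a : ℝ) (G : E d → E d) : ℝ :=
  ∫ x, ‖G x‖ ^ 2 / ‖x‖ ^ (2 * a)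

/-- The integrand `|u|² / |x|^{2(a+1)} * log (|x|^{d-2-2a} |u|²)` (zero where `u = 0`). -/
def logDensity {d : ℕ} (a : ℝ) (u : E d → ℝ) (x : E d) : ℝ :=
  u x ^ 2 / ‖x‖ ^ (2 * (a + 1)) * Real.log (‖x‖ ^ ((d : ℝ) - 2 - 2 * a) * u x ^ 2)

/-- The extended-real integral of `f`, the integral of the positive part minus the integral of the
negative part; meaningful when the former is finite, the value `-∞` being allowed. -/
def extIntegral {d : ℕ} (f : E d → ℝ) : EReal :=
  ((∫⁻ x, ENNReal.ofReal (f x) : ENNReal) : EReal)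
    - ((∫⁻ x, ENNReal.ofReal (-f x) : ENNReal) : EReal)

/-- The explicit constant `C*_GLH`, for `γ ≥ 1/4`. -/
def logHardyConst (d : ℕ) (a γ : ℝ) : ℝ :=
  if γ = 1 / 4 then
    4 * (Real.Gamma ((d : ℝ) / 2) ^ 2 / (8 * Real.pi ^ (d + 1) * Real.exp 1))
  else
    1 / γ
      * (Real.Gamma ((d : ℝ) / 2) ^ (1 / (2 * γ))
          / (8 * Real.pi ^ (d + 1) * Real.exp 1) ^ (1 / (4 * γ)))
      * ((4 * γ - 1) / ((d : ℝ) - 2 - 2 * a) ^ 2) ^ ((4 * γ - 1) / (4 * γ))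

/-- The extremal function before normalization,
`|x|^{-(d-2-2a)/2} exp (-((d-2-2a)² / (4 (4γ-1))) (log |x|)²)`. -/
def extremalProfile (d : ℕ) (a γ : ℝ) (x : E d) : ℝ :=
  ‖x‖ ^ (-(((d : ℝ) - 2 - 2 * a) / 2))
    * Real.exp (-(((d : ℝ) - 2 - 2 * a) ^ 2 / (4 * (4 * γ - 1))) * Real.log ‖x‖ ^ 2)

/-- The extremal function, normalized so that its weighted mass is one. -/
def extremal (d : ℕ) (a γ : ℝ) (x : E d) : ℝ :=
  extremalProfile d a γ x / Real.sqrt (weightedMass a (extremalProfile d a γ))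

end LogHardy

end

/-! Put c = d - 2 - 2a, let S be the area of the unit sphere, and write u(x) = |x|^{-c/2} w(s) with
s = log |x|. Up to the factor S, the weighted mass becomes ∫ w², the left-hand side becomes ∫ w² log
w², and the energy of a radial function becomes ∫ w'² + (c/2)² ∫ w², because the cross term is a
multiple of ∫ w w' = 0. The claim is thus the logarithmic Sobolev inequality on the line, followed
by the choice of one scalar parameter (`entropy_bound_le_log`).

The one-dimensional inequality (`SobolevLimit.entropy_bound`) is proved by mass transport. A
monotone map T carries w² to the Gaussian truncated to [-N, N], so that M w² = exp(-T²/2) T', where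
M is the truncated Gaussian mass. Taking logarithms, bounding log (μ T') by μ T' - 1, integrating T'
w² by parts and completing the square leaves only ∫ w'². Truncation keeps T and T' bounded, which
justifies the integration by parts for every w in H¹; letting N tend to infinity turns M into √(2π).

Membership in the completion only provides approximating test functions, which need not be radial.
`exists_good_ray` selects one ray along which suitably chosen approximants converge and whose energy
is at most the spherical average. Restriction to that ray shows that w is in H¹(ℝ), and the radial
component of the gradient bounds the energy from below (`HasWeightedGradient.exists_profile`).

Gaussians w = A exp(-κ s²) give equality in the logarithmic Sobolev inequality, and κ = c²/(4(4γ-1))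
gives equality in the choice of parameter as well. For γ = 1/4 this κ is infinite, and sharpness
comes from the limit κ → ∞. -/

noncomputable section

namespace LogHardy

/-! ### Logarithmic polar coordinates -/

open Set in
theorem lintegral_Ioi_eq_lintegral_exp (g : ℝ → ENNReal) :
    ∫⁻ r in Ioi (0 : ℝ), g r = ∫⁻ s : ℝ, ENNReal.ofReal (Real.exp s) * g (Real.exp s) := by
  have h := lintegral_image_eq_lintegral_abs_deriv_mul (s := univ) (f := Real.exp)
    (f' := Real.exp) MeasurableSet.univ (fun x _ => (Real.hasDerivAt_exp x).hasDerivWithinAt)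
    Real.exp_injective.injOn g
  rw [image_univ, Real.range_exp] at h
  simpa using h

/-- Logarithmic polar coordinates. -/
theorem lintegral_polar {d : ℕ} (hd : 1 ≤ d) {Φ : E d → ENNReal} (hΦ : Measurable Φ) :
    ∫⁻ x, Φ x = ∫⁻ z, (∫⁻ s : ℝ, ENNReal.ofReal (Real.exp (d * s)) *
      Φ (Real.exp s • (z : E d))) ∂(volume : Measure (E d)).toSphere := by
  have : Nonempty (Fin d) := ⟨⟨0, hd⟩⟩
  have hmp := (volume : Measure (E d)).measurePreserving_homeomorphUnitSphereProd
  have hm : Measurable fun p : Metric.sphere (0 : E d) 1 × Set.Ioi (0 : ℝ) =>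
      Φ ((p.2 : ℝ) • (p.1 : E d)) := by
    refine hΦ.comp ?_
    fun_prop
  have h1 : ∫⁻ x, Φ x = ∫⁻ x : ({(0)}ᶜ : Set (E d)), Φ (x : E d) ∂(volume.comap Subtype.val) := by
    rw [lintegral_subtype_comap (measurableSet_singleton _).compl, restrict_compl_singleton]
  have h2 := hmp.lintegral_comp hm
  have h3 : ∀ x : ({(0)}ᶜ : Set (E d)),
      (((homeomorphUnitSphereProd (E d) x).2 : ℝ) • ((homeomorphUnitSphereProd (E d) x).1 : E d))
        = x := by
    intro x
    have hx : ‖(x : E d)‖ ≠ 0 := norm_ne_zero_iff.2 x.2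
    simp [smul_smul, hx]
  simp only [h3] at h2
  rw [h1, h2, lintegral_prod _ hm.aemeasurable]
  refine lintegral_congr fun z => ?_
  have hm' : Measurable fun r : Set.Ioi (0 : ℝ) => Φ ((r : ℝ) • (z : E d)) :=
    hΦ.comp (by fun_prop)
  rw [Measure.volumeIoiPow, lintegral_withDensity_eq_lintegral_mul _ (by fun_prop) hm']
  simp only [Pi.mul_apply]
  rw [lintegral_subtype_comap measurableSet_Ioi
    (fun r : ℝ => ENNReal.ofReal (r ^ (Module.finrank ℝ (E d) - 1)) * Φ (r • (z : E d))),
    lintegral_Ioi_eq_lintegral_exp]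
  refine lintegral_congr fun s => ?_
  rw [← mul_assoc, ← ENNReal.ofReal_mul (Real.exp_pos s).le]
  congr 2
  rw [finrank_euclideanSpace_fin, ← Real.exp_nat_mul, ← Real.exp_add, Nat.cast_sub hd]
  congr 1
  push_cast
  ring

/-- The area of the unit sphere of `ℝ^d`. -/
def sphereArea (d : ℕ) : ℝ := 2 * Real.pi ^ ((d : ℝ) / 2) / Real.Gamma ((d : ℝ) / 2)

theorem sphereArea_pos {d : ℕ} (hd : 1 ≤ d) : 0 < sphereArea d := by
  have : (0 : ℝ) < d := by exact_mod_cast hd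
  have := Real.Gamma_pos_of_pos (half_pos this)
  unfold sphereArea
  positivity

theorem toSphere_univ {d : ℕ} (hd : 1 ≤ d) :
    (volume : Measure (E d)).toSphere Set.univ = ENNReal.ofReal (sphereArea d) := by
  have : Nonempty (Fin d) := ⟨⟨0, hd⟩⟩
  have h0 : (0 : ℝ) < d := by exact_mod_cast hd
  rw [Measure.toSphere_apply_univ, EuclideanSpace.volume_ball, finrank_euclideanSpace_fin,
    Fintype.card_fin, ENNReal.ofReal_one, one_pow, one_mul, ← ENNReal.ofReal_natCast,
    ← ENNReal.ofReal_mul (by positivity), Real.Gamma_add_one (by positivity), sphereArea,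
    Real.sqrt_eq_rpow, ← Real.rpow_natCast, ← Real.rpow_mul Real.pi_pos.le]
  congr 1
  have := Real.Gamma_pos_of_pos (half_pos h0)
  field_simp

theorem norm_exp_smul {d : ℕ} (z : Metric.sphere (0 : E d) 1) (s : ℝ) :
    ‖Real.exp s • (z : E d)‖ = Real.exp s := by
  simp [norm_smul]

/-- The factor |x|^{-d} cancels the Jacobian e^{ds}, so a radial integral turns into one against
Lebesgue measure in s = log |x|. -/
theorem lintegral_radial {d : ℕ} (hd : 1 ≤ d) {K : ℝ → ENNReal} (hK : Measurable K)
    {Φ : E d → ENNReal} (hΦ : ∀ᵐ x : E d, Φ x = ENNReal.ofReal (‖x‖ ^ (-(d : ℝ))) * K (Real.log ‖x‖)) :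
    ∫⁻ x, Φ x = ENNReal.ofReal (sphereArea d) * ∫⁻ s, K s := by
  rw [lintegral_congr_ae hΦ, lintegral_polar hd (by fun_prop), ← toSphere_univ hd,
    mul_comm, ← lintegral_const]
  refine lintegral_congr fun z => lintegral_congr fun s => ?_
  rw [norm_exp_smul, Real.log_exp, ← Real.exp_mul, ← mul_assoc,
    ← ENNReal.ofReal_mul (Real.exp_pos _).le, ← Real.exp_add]
  simp [mul_comm]

theorem norm_ne_zero_ae {d : ℕ} (hd : 1 ≤ d) : ∀ᵐ x : E d, 0 < ‖x‖ := by
  have : Nonempty (Fin d) := ⟨⟨0, hd⟩⟩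
  have := Measure.ae_ne (volume : Measure (E d)) 0
  filter_upwards [this] with x hx using norm_pos_iff.2 hx

/-! ### Convergence in L² -/

section L2

variable {α : Type*} [MeasurableSpace α] {μ : Measure α}

/-- Continuity of the inner product of L²; it carries integration by parts from the approximants to
the limit. -/
theorem tendsto_integral_mul {a b : ℕ → α → ℝ} {f g : α → ℝ}
    (ha : ∀ n, MemLp (a n) 2 μ) (hb : ∀ n, MemLp (b n) 2 μ) (hf : MemLp f 2 μ) (hg : MemLp g 2 μ)
    (haf : Tendsto (fun n => eLpNorm (a n - f) 2 μ) atTop (𝓝 0))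
    (hbg : Tendsto (fun n => eLpNorm (b n - g) 2 μ) atTop (𝓝 0)) :
    Tendsto (fun n => ∫ x, a n x * b n x ∂μ) atTop (𝓝 (∫ x, f x * g x ∂μ)) := by
  have h1 := (Lp.tendsto_Lp_iff_tendsto_eLpNorm'' a ha f hf).2 haf
  have h2 := (Lp.tendsto_Lp_iff_tendsto_eLpNorm'' b hb g hg).2 hbg
  have key : ∀ {p q : α → ℝ} (hp : MemLp p 2 μ) (hq : MemLp q 2 μ),
      inner ℝ (hp.toLp p) (hq.toLp q) = ∫ x, p x * q x ∂μ := by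
    intro p q hp hq
    rw [L2.inner_def]
    refine integral_congr_ae ?_
    filter_upwards [hp.coeFn_toLp, hq.coeFn_toLp] with x h1 h2
    rw [h1, h2]
    simp [mul_comm]
  have := h1.inner (𝕜 := ℝ) h2
  simpa only [key] using this

theorem eLpNorm_two_sq_eq {f : α → ℝ} :
    eLpNorm f 2 μ ^ (2 : ℝ) = ∫⁻ x, ENNReal.ofReal (f x ^ 2) ∂μ := by
  rw [eLpNorm_eq_lintegral_rpow_enorm_toReal (by simp) (by simp), ← ENNReal.rpow_mul]
  simp only [ENNReal.toReal_ofNat]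
  norm_num
  refine lintegral_congr fun x => ?_
  rw [← ofReal_norm, ← ENNReal.ofReal_pow (norm_nonneg _)]
  simp

theorem memLp_two_of_lintegral_lt_top {f : α → ℝ} (hm : AEStronglyMeasurable f μ)
    (h : ∫⁻ x, ENNReal.ofReal (f x ^ 2) ∂μ < ⊤) : MemLp f 2 μ := by
  refine ⟨hm, ?_⟩
  rw [← eLpNorm_two_sq_eq] at h
  exact (ENNReal.rpow_lt_top_iff_of_pos (by norm_num)).1 h

theorem tendsto_eLpNorm_two {f : ℕ → α → ℝ}
    (h : Tendsto (fun n => ∫⁻ x, ENNReal.ofReal (f n x ^ 2) ∂μ) atTop (𝓝 0)) :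
    Tendsto (fun n => eLpNorm (f n) 2 μ) atTop (𝓝 0) := by
  have h1 := (ENNReal.continuous_rpow_const (y := 1 / 2)).tendsto 0 |>.comp h
  rw [ENNReal.zero_rpow_of_pos (by norm_num)] at h1
  refine h1.congr fun n => ?_
  rw [Function.comp_apply, ← eLpNorm_two_sq_eq, ← ENNReal.rpow_mul]
  norm_num

end L2

/-! ### Sobolev functions on the line -/

/-- `(w, w')` is the limit in `L²` of pairs `(v n, v' n)` of differentiable functions vanishing at
infinity and their derivatives. -/
structure SobolevLimit (v v' : ℕ → ℝ → ℝ) (w w' : ℝ → ℝ) : Prop where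
  hasDerivAt : ∀ n s, HasDerivAt (v n) (v' n s) s
  memLp : ∀ n, MemLp (v n) 2 volume
  memLp_deriv : ∀ n, MemLp (v' n) 2 volume
  atBot : ∀ n, Tendsto (v n) atBot (𝓝 0)
  atTop : ∀ n, Tendsto (v n) atTop (𝓝 0)
  memLp_limit : MemLp w 2 volume
  memLp_limit_deriv : MemLp w' 2 volume
  tendsto : Tendsto (fun n => eLpNorm (v n - w) 2 volume) Filter.atTop (𝓝 0)
  tendsto_deriv : Tendsto (fun n => eLpNorm (v' n - w') 2 volume) Filter.atTop (𝓝 0)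

/-- Integrate (f²)' = 2 f f' ≤ f² + f'² from -∞. Applied to differences of approximants, this makes
L² convergence uniform. -/
theorem sq_le_integral_sq_add {f f' : ℝ → ℝ} (hf : ∀ s, HasDerivAt f (f' s) s)
    (h2 : MemLp f 2 volume) (h2' : MemLp f' 2 volume) (hbot : Tendsto f atBot (𝓝 0)) (s : ℝ) :
    f s ^ 2 ≤ (∫ x, f x ^ 2) + ∫ x, f' x ^ 2 := by
  have hi : Integrable (fun x => f x * f' x) := h2.integrable_mul h2'
  have h1 : ∫ x in Set.Iic s, 2 * (f x * f' x) = f s ^ 2 - 0 := by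
    refine integral_Iic_of_hasDerivAt_of_tendsto' (f := fun x => f x ^ 2) (fun x _ => ?_)
      (hi.const_mul 2).integrableOn ?_
    · exact ((hf x).fun_pow 2).congr_deriv (by norm_num; ring)
    · simpa using hbot.pow 2
  rw [sub_zero] at h1
  have hsum := h2.integrable_sq.add h2'.integrable_sq
  rw [← h1, ← integral_add h2.integrable_sq h2'.integrable_sq]
  refine (setIntegral_mono (hi.const_mul 2).integrableOn hsum.integrableOn fun x => ?_).trans
    (setIntegral_le_integral hsum (Eventually.of_forall fun x => ?_))
  · simp only [Pi.add_apply]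
    nlinarith [sq_nonneg (f x - f' x)]
  · simp only [Pi.zero_apply, Pi.add_apply]
    positivity

theorem integral_sq_eq_norm_toLp_sq {f : ℝ → ℝ} (h : MemLp f 2 volume) :
    ∫ x, f x ^ 2 = ‖h.toLp f‖ ^ 2 := by
  rw [integral_eq_lintegral_of_nonneg_ae (Eventually.of_forall fun x => sq_nonneg _)
    h.integrable_sq.aestronglyMeasurable, ← eLpNorm_two_sq_eq, Lp.norm_toLp]
  norm_num

namespace SobolevLimit

variable {v v' : ℕ → ℝ → ℝ} {w w' : ℝ → ℝ}

/-- The approximants are Cauchy in the supremum norm, and their uniform limit agrees with w almost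
everywhere along a subsequence. Continuity makes the distribution function of w² differentiable
everywhere, and boundedness makes T' bounded. -/
theorem exists_continuous (H : SobolevLimit v v' w w') :
    ∃ V : BoundedContinuousFunction ℝ ℝ, w =ᵐ[volume] V := by
  have hcont : ∀ n, Continuous (v n) := fun n =>
    continuous_iff_continuousAt.2 fun s => (H.hasDerivAt n s).continuousAt
  have hbd : ∀ n s, ‖v n s‖ ≤ √((∫ x, v n x ^ 2) + ∫ x, v' n x ^ 2) := fun n s => by
    rw [Real.norm_eq_abs]
    exact Real.abs_le_sqrt
      (sq_le_integral_sq_add (H.hasDerivAt n) (H.memLp n) (H.memLp_deriv n) (H.atBot n) s)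
  let V : ℕ → BoundedContinuousFunction ℝ ℝ := fun n =>
    BoundedContinuousFunction.ofNormedAddCommGroup (v n) (hcont n) _ (hbd n)
  have h1 := ((Lp.tendsto_Lp_iff_tendsto_eLpNorm'' v H.memLp w H.memLp_limit).2
    H.tendsto).cauchySeq
  have h2 := ((Lp.tendsto_Lp_iff_tendsto_eLpNorm'' v' H.memLp_deriv w' H.memLp_limit_deriv).2
    H.tendsto_deriv).cauchySeq
  have hsq : ∀ {p q : ℝ}, 0 ≤ p → 0 ≤ q → p ^ 2 + q ^ 2 ≤ (p + q) ^ 2 := fun hp hq => by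
    nlinarith [mul_nonneg hp hq]
  have hdist : ∀ n m, dist (V n) (V m) ≤ dist ((H.memLp n).toLp (v n)) ((H.memLp m).toLp (v m)) +
      dist ((H.memLp_deriv n).toLp (v' n)) ((H.memLp_deriv m).toLp (v' m)) := by
    intro n m
    rw [BoundedContinuousFunction.dist_le (by positivity)]
    intro s
    have h := sq_le_integral_sq_add (f := v n - v m) (f' := v' n - v' m)
      (fun s => (H.hasDerivAt n s).sub (H.hasDerivAt m s))
      ((H.memLp n).sub (H.memLp m)) ((H.memLp_deriv n).sub (H.memLp_deriv m))
      (by simpa [Pi.sub_def] using (H.atBot n).sub (H.atBot m)) s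
    rw [integral_sq_eq_norm_toLp_sq ((H.memLp n).sub (H.memLp m)),
      integral_sq_eq_norm_toLp_sq ((H.memLp_deriv n).sub (H.memLp_deriv m)),
      MemLp.toLp_sub (H.memLp n) (H.memLp m),
      MemLp.toLp_sub (H.memLp_deriv n) (H.memLp_deriv m), ← dist_eq_norm, ← dist_eq_norm] at h
    change |v n s - v m s| ≤ _
    exact abs_le_of_sq_le_sq (h.trans (hsq dist_nonneg dist_nonneg)) (by positivity)
  have hC : CauchySeq V := by
    rw [Metric.cauchySeq_iff] at h1 h2 ⊢
    intro ε hε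
    obtain ⟨N₁, hN₁⟩ := h1 (ε / 2) (by positivity)
    obtain ⟨N₂, hN₂⟩ := h2 (ε / 2) (by positivity)
    refine ⟨max N₁ N₂, fun n hn m hm => (hdist n m).trans_lt ?_⟩
    have := hN₁ n (le_of_max_le_left hn) m (le_of_max_le_left hm)
    have := hN₂ n (le_of_max_le_right hn) m (le_of_max_le_right hm)
    linarith
  obtain ⟨W, hW⟩ := cauchySeq_tendsto_of_complete hC
  refine ⟨W, ?_⟩
  have hmeas := tendstoInMeasure_of_tendsto_eLpNorm (by norm_num)
    (fun n => (H.memLp n).aestronglyMeasurable) H.memLp_limit.aestronglyMeasurable H.tendsto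
  obtain ⟨ns, hns, hae⟩ := hmeas.exists_seq_tendsto_ae
  filter_upwards [hae] with x hx
  refine tendsto_nhds_unique hx ?_
  have := (BoundedContinuousFunction.tendsto_iff_tendstoUniformly.1 hW).tendsto_at x
  exact this.comp hns.tendsto_atTop

/-- This is ∫ (T w²)' = 0. It holds for each `v n`, whose decay kills the boundary terms, and passes
to the limit because multiplication by the bounded functions T and T' preserves L² convergence. -/
theorem integral_mul_deriv_eq_zero (H : SobolevLimit v v' w w') {T T' : ℝ → ℝ} {A B : ℝ}
    (hT : ∀ s, HasDerivAt T (T' s) s) (hA : ∀ s, |T s| ≤ A) (hT'c : Continuous T')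
    (hB : ∀ s, |T' s| ≤ B) :
    ∫ s, w s * (T' s * w s) + 2 * (w' s * (T s * w s)) = 0 := by
  have hTc : Continuous T := continuous_iff_continuousAt.2 fun s => (hT s).continuousAt
  have hmul : ∀ {p : ℝ → ℝ} {R : ℝ → ℝ} {M : ℝ}, Continuous R → (∀ s, |R s| ≤ M) →
      MemLp p 2 volume → MemLp (fun s => R s * p s) 2 volume := by
    intro p R M hR hM hp
    exact hp.of_le_mul (c := M) (hR.aestronglyMeasurable.mul hp.aestronglyMeasurable)
      (Eventually.of_forall fun s => by
        rw [norm_mul]; exact mul_le_mul_of_nonneg_right (hM s) (norm_nonneg _))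
  have hlim : ∀ {R : ℝ → ℝ} {M : ℝ}, Continuous R → (∀ s, |R s| ≤ M) →
      Tendsto (fun n => eLpNorm ((fun s => R s * v n s) - fun s => R s * w s) 2 volume)
        Filter.atTop (𝓝 0) := by
    intro R M hR hM
    have h0 : Tendsto (fun n => ENNReal.ofReal M * eLpNorm (v n - w) 2 volume)
        Filter.atTop (𝓝 0) := by
      simpa using ENNReal.Tendsto.const_mul H.tendsto (Or.inr ENNReal.ofReal_ne_top)
    refine tendsto_of_tendsto_of_tendsto_of_le_of_le tendsto_const_nhds h0
      (fun _ => zero_le) fun n => ?_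
    refine eLpNorm_le_mul_eLpNorm_of_ae_le_mul (Eventually.of_forall fun s => ?_) 2
    simp only [Pi.sub_apply, ← mul_sub, norm_mul]
    exact mul_le_mul_of_nonneg_right (hM s) (norm_nonneg _)
  have l1 := tendsto_integral_mul H.memLp (fun n => hmul hT'c hB (H.memLp n)) H.memLp_limit
    (hmul hT'c hB H.memLp_limit) H.tendsto (hlim hT'c hB)
  have l2 := tendsto_integral_mul H.memLp_deriv (fun n => hmul hTc hA (H.memLp n))
    H.memLp_limit_deriv (hmul hTc hA H.memLp_limit) H.tendsto_deriv (hlim hTc hA)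
  have hz : ∀ n, (∫ s, v n s * (T' s * v n s)) + 2 * ∫ s, v' n s * (T s * v n s) = 0 := by
    intro n
    have i1 : Integrable fun s => v n s * (T' s * v n s) :=
      (H.memLp n).integrable_mul (hmul hT'c hB (H.memLp n))
    have i2 : Integrable fun s => v' n s * (T s * v n s) :=
      (H.memLp_deriv n).integrable_mul (hmul hTc hA (H.memLp n))
    rw [← integral_const_mul, ← integral_add i1 (i2.const_mul 2)]
    have hb : ∀ {l : Filter ℝ}, Tendsto (v n) l (𝓝 0) →
        Tendsto (fun s => v n s ^ 2 * T s) l (𝓝 0) := by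
      intro l hl
      have h2 : Tendsto (fun s => v n s ^ 2 * A) l (𝓝 0) := by
        simpa using (hl.pow 2).mul_const A
      refine squeeze_zero_norm (fun s => ?_) h2
      rw [norm_mul, norm_pow, Real.norm_eq_abs, Real.norm_eq_abs, sq_abs]
      exact mul_le_mul_of_nonneg_left (hA s) (sq_nonneg _)
    have := integral_of_hasDerivAt_of_tendsto (f := fun s => v n s ^ 2 * T s)
      (f' := fun s => v n s * (T' s * v n s) + 2 * (v' n s * (T s * v n s)))
      (fun s => (((H.hasDerivAt n s).fun_pow 2).fun_mul (hT s)).congr_deriv (by norm_num; ring)) (i1.add (i2.const_mul 2)) (hb (H.atBot n)) (hb (H.atTop n))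
    simpa using this
  have i1 : Integrable fun s => w s * (T' s * w s) :=
    H.memLp_limit.integrable_mul (hmul hT'c hB H.memLp_limit)
  have i2 : Integrable fun s => w' s * (T s * w s) :=
    H.memLp_limit_deriv.integrable_mul (hmul hTc hA H.memLp_limit)
  rw [integral_add i1 (i2.const_mul 2), integral_const_mul]
  refine tendsto_nhds_unique (l1.add (l2.const_mul 2)) ?_
  simp only [hz]
  exact tendsto_const_nhds

end SobolevLimit

/-! ### Logarithmic Sobolev inequality on the line by mass transport -/

/-- A monotone map transporting a continuous probability density on the line to the standard
Gaussian density truncated to `[-N, N]`. -/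
theorem exists_transport {f : ℝ → ℝ} (hf : Continuous f) (h0 : ∀ s, 0 ≤ f s)
    (hi : Integrable f) (h1 : ∫ s, f s = 1) {N : ℝ} (hN : 0 < N) :
    ∃ T : ℝ → ℝ, (∀ s, |T s| ≤ N) ∧ ∀ s, HasDerivAt T
      ((∫ t in -N..N, Real.exp (-(t ^ 2) / 2)) * f s * Real.exp (T s ^ 2 / 2)) s := by
  set M := ∫ t in -N..N, Real.exp (-(t ^ 2) / 2) with hM
  -- Cutting the Gaussian off from below at its value at ±N leaves it unchanged on [-N, N] and makes
  -- its primitive G a bijection of ℝ with an inverse differentiable everywhere.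
  let δ : ℝ := Real.exp (-(N ^ 2) / 2)
  let g : ℝ → ℝ := fun t => max (Real.exp (-(t ^ 2) / 2)) δ
  have hδ : 0 < δ := Real.exp_pos _
  have hgc : Continuous g := by fun_prop
  have hgδ : ∀ t, δ ≤ g t := fun t => le_max_right _ _
  have hgN : ∀ t, |t| ≤ N → g t = Real.exp (-(t ^ 2) / 2) := by
    intro t ht
    refine max_eq_left (Real.exp_le_exp.2 ?_)
    have := sq_le_sq' (abs_le.1 ht).1 (abs_le.1 ht).2
    linarith
  let G : ℝ → ℝ := fun y => ∫ t in (0 : ℝ)..y, g t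
  have hG : ∀ y, HasDerivAt G (g y) y := fun y =>
    intervalIntegral.integral_hasDerivAt_right (hgc.intervalIntegrable _ _)
      (hgc.stronglyMeasurableAtFilter _ _) hgc.continuousAt
  have hGc : Continuous G := continuous_iff_continuousAt.2 fun y => (hG y).continuousAt
  have hG0 : G 0 = 0 := by simp [G]
  have hmono : StrictMono G := strictMono_of_hasDerivAt_pos hG fun y => hδ.trans_le (hgδ y)
  have hmono' : Monotone fun y => G y - δ * y := by
    refine monotone_of_deriv_nonneg (fun y => ((hG y).sub
      ((hasDerivAt_id y).const_mul δ)).differentiableAt) fun y => ?_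
    have := ((hG y).sub ((hasDerivAt_id y).const_mul δ)).deriv
    simp only [mul_one] at this
    exact (sub_nonneg.2 (hgδ y)).trans_eq this.symm
  have htop : Tendsto G atTop atTop := by
    refine tendsto_atTop_mono' _ ?_ (tendsto_id.const_mul_atTop hδ)
    filter_upwards [eventually_ge_atTop 0] with y hy
    have := hmono' hy
    simp only [hG0] at this
    simp only [id]
    linarith
  have hbot : Tendsto G atBot atBot := by
    refine tendsto_atBot_mono' _ ?_ (tendsto_id.const_mul_atBot hδ)
    filter_upwards [eventually_le_atBot 0] with y hy
    have := hmono' hy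
    simp only [hG0] at this
    simp only [id]
    linarith
  let Φ := hmono.orderIsoOfSurjective G (hGc.surjective htop hbot)
  have hΦ : ∀ z, G (Φ.symm z) = z := fun z => Φ.apply_symm_apply z
  have hΦ' : ∀ y, Φ.symm (G y) = y := fun y => Φ.symm_apply_apply y
  have hd : ∀ z, HasDerivAt Φ.symm (g (Φ.symm z))⁻¹ z := fun z =>
    HasDerivAt.of_local_left_inverse Φ.symm.continuous.continuousAt (hG _)
      (hδ.trans_le (hgδ _)).ne' (Eventually.of_forall hΦ)
  let F : ℝ → ℝ := fun s => ∫ t in Set.Iic s, f t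
  have hF : ∀ s, HasDerivAt F (f s) s := by
    intro s
    have h := (intervalIntegral.integral_hasDerivAt_right (hf.intervalIntegrable 0 s)
      (hf.stronglyMeasurableAtFilter _ _) hf.continuousAt).add_const (F 0)
    refine h.congr_of_eventuallyEq (Eventually.of_forall fun y => ?_)
    have := intervalIntegral.integral_Iic_sub_Iic (μ := volume) (f := f) (a := 0) (b := y)
      hi.integrableOn hi.integrableOn
    simp only [F]
    linarith
  have hF0 : ∀ s, 0 ≤ F s := fun s => setIntegral_nonneg measurableSet_Iic fun t _ => h0 t
  have hF1 : ∀ s, F s ≤ 1 := fun s => by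
    rw [← h1]
    exact setIntegral_le_integral hi (Eventually.of_forall h0)
  have hGM : G N - G (-N) = M := by
    have h := intervalIntegral.integral_interval_sub_left (a := 0) (b := N) (c := -N) (f := g)
      (μ := volume) (hgc.intervalIntegrable _ _) (hgc.intervalIntegrable _ _)
    refine h.trans (intervalIntegral.integral_congr fun t ht => hgN t ?_)
    rw [Set.uIcc_of_le (by linarith)] at ht
    exact abs_le.2 ht
  have hM0 : 0 ≤ M := by
    rw [← hGM]
    exact sub_nonneg.2 (hmono.monotone (by linarith))
  have hTN : ∀ s, |Φ.symm (M * F s + G (-N))| ≤ N := by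
    intro s
    rw [abs_le]
    constructor
    · calc -N = Φ.symm (G (-N)) := (hΦ' _).symm
        _ ≤ _ := Φ.symm.monotone (by linarith [mul_nonneg hM0 (hF0 s)])
    · calc _ ≤ Φ.symm (G N) := Φ.symm.monotone (by nlinarith [hF1 s])
        _ = N := hΦ' _
  -- T = G⁻¹(M F + G(-N)), with F the distribution function of f. Since 0 ≤ F ≤ 1 and G(N) - G(-N) =
  -- M, the values stay in [-N, N], where 1/g is exp(T²/2).
  refine ⟨fun s => Φ.symm (M * F s + G (-N)), hTN, fun s => ?_⟩
  have := (hd (M * F s + G (-N))).comp s (((hF s).const_mul M).add_const (G (-N)))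
  refine this.congr_deriv ?_
  rw [hgN _ (hTN s), ← Real.exp_neg]
  ring_nf

theorem tendsto_integral_truncated_gaussian :
    Tendsto (fun N : ℝ => ∫ t in -N..N, Real.exp (-(t ^ 2) / 2)) atTop
      (𝓝 √(2 * Real.pi)) := by
  have h : ∀ t : ℝ, Real.exp (-(t ^ 2) / 2) = Real.exp (-(1 / 2) * t ^ 2) := fun t => by
    ring_nf
  have hi : Integrable fun t : ℝ => Real.exp (-(1 / 2) * t ^ 2) :=
    integrable_exp_neg_mul_sq (by norm_num)
  have := intervalIntegral_tendsto_integral hi tendsto_neg_atTop_atBot tendsto_id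
  rw [integral_gaussian] at this
  simp only [h]
  rwa [show 2 * Real.pi = Real.pi / (1 / 2) by ring]

namespace SobolevLimit

variable {v v' : ℕ → ℝ → ℝ} {w w' : ℝ → ℝ}

/-- Where w ≠ 0, log T' = log M + log w² + T²/2, and log (μ T') ≤ μ T' - 1 yields the pointwise
majorant q. In its integral, ∫ T' w² = -2 ∫ T w w', and (T w + 2μ w')² ≥ 0 absorbs the remaining
term -T² w²/2. A majorant is used because the negative part of w² log w² need not be integrable. -/
theorem entropy_bound_truncated (H : SobolevLimit v v' w w') (h1 : ∫ s, w s ^ 2 = 1)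
    {μ N : ℝ} (hμ : 0 < μ) (hN : 0 < N) :
    ∃ q : ℝ → ℝ, Integrable q ∧ (∀ᵐ s, w s ^ 2 * Real.log (w s ^ 2) ≤ q s) ∧
      ∫ s, q s ≤ -Real.log (∫ t in -N..N, Real.exp (-(t ^ 2) / 2)) - 1 - Real.log μ
        + 2 * μ ^ 2 * ∫ s, w' s ^ 2 := by
  obtain ⟨V, hV⟩ := H.exists_continuous
  have hV2 : (fun s => w s ^ 2) =ᵐ[volume] fun s => V s ^ 2 := hV.fun_comp (· ^ 2)
  have hVc : Continuous fun s => V s ^ 2 := by fun_prop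
  obtain ⟨T, hTN, hT⟩ := exists_transport hVc (fun s => sq_nonneg _)
    (H.memLp_limit.integrable_sq.congr hV2) ((integral_congr_ae hV2).symm.trans h1) hN
  set M := ∫ t in -N..N, Real.exp (-(t ^ 2) / 2) with hM
  have hM0 : 0 < M := intervalIntegral.intervalIntegral_pos_of_pos
    ((by fun_prop : Continuous fun t : ℝ => Real.exp (-(t ^ 2) / 2)).intervalIntegrable _ _)
    (fun t => Real.exp_pos _) (by linarith)
  set T' : ℝ → ℝ := fun s => M * V s ^ 2 * Real.exp (T s ^ 2 / 2) with hT'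
  have hTc : Continuous T := continuous_iff_continuousAt.2 fun s => (hT s).continuousAt
  have hT'c : Continuous T' := by fun_prop
  have hT'b : ∀ s, |T' s| ≤ M * ‖V‖ ^ 2 * Real.exp (N ^ 2 / 2) := by
    intro s
    have h2 : V s ^ 2 ≤ ‖V‖ ^ 2 := by
      rw [← sq_abs]
      exact pow_le_pow_left₀ (abs_nonneg _) (V.norm_coe_le_norm s) 2
    have h3 : T s ^ 2 ≤ N ^ 2 := sq_le_sq' (abs_le.1 (hTN s)).1 (abs_le.1 (hTN s)).2
    rw [abs_of_nonneg (by positivity)]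
    simp only [hT']
    gcongr
  have hz := H.integral_mul_deriv_eq_zero hT hTN hT'c hT'b
  have m1 : MemLp (fun s => T' s * w s) 2 volume :=
    H.memLp_limit.of_le_mul (hT'c.aestronglyMeasurable.mul H.memLp_limit.aestronglyMeasurable)
      (Eventually.of_forall fun s => by
        rw [norm_mul]; exact mul_le_mul_of_nonneg_right (hT'b s) (norm_nonneg _))
  have m2 : MemLp (fun s => T s * w s) 2 volume :=
    H.memLp_limit.of_le_mul (hTc.aestronglyMeasurable.mul H.memLp_limit.aestronglyMeasurable)
      (Eventually.of_forall fun s => by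
        rw [norm_mul]; exact mul_le_mul_of_nonneg_right (hTN s) (norm_nonneg _))
  have i1 : Integrable fun s => w s * (T' s * w s) := H.memLp_limit.integrable_mul m1
  have i2 : Integrable fun s => w' s * (T s * w s) := H.memLp_limit_deriv.integrable_mul m2
  have i3 := m2.integrable_sq
  have i4 := H.memLp_limit.integrable_sq
  have i5 := H.memLp_limit_deriv.integrable_sq
  set C := Real.log M + 1 + Real.log μ with hC
  have iq : Integrable fun s => μ * (w s * (T' s * w s)) - C * w s ^ 2
      - 1 / 2 * (T s * w s) ^ 2 :=
    ((i1.const_mul μ).sub (i4.const_mul C)).sub (i3.const_mul (1 / 2))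
  have iz : Integrable fun s => w s * (T' s * w s) + 2 * (w' s * (T s * w s)) :=
    i1.add (i2.const_mul 2)
  refine ⟨_, iq, ?_, ?_⟩
  · filter_upwards [hV] with s hs
    rcases eq_or_ne (w s) 0 with h0 | h0
    · simp [h0]
    · have hw2 : 0 < w s ^ 2 := by positivity
      have hT's : T' s = M * w s ^ 2 * Real.exp (T s ^ 2 / 2) := by rw [hT', hs]
      have hTpos : 0 < T' s := by rw [hT's]; positivity
      have hlogT : Real.log (T' s) = Real.log M + Real.log (w s ^ 2) + T s ^ 2 / 2 := by
        rw [hT's, Real.log_mul (by positivity) (by positivity),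
          Real.log_mul (by positivity) (by positivity), Real.log_exp]
      have hle := Real.log_le_sub_one_of_pos (mul_pos hμ hTpos)
      rw [Real.log_mul (by positivity) (by positivity), hlogT] at hle
      have := mul_le_mul_of_nonneg_left hle hw2.le
      rw [hC]
      linarith
  · calc ∫ s, (μ * (w s * (T' s * w s)) - C * w s ^ 2 - 1 / 2 * (T s * w s) ^ 2)
        = ∫ s, ((μ * (w s * (T' s * w s)) - C * w s ^ 2 - 1 / 2 * (T s * w s) ^ 2)
          - μ * (w s * (T' s * w s) + 2 * (w' s * (T s * w s)))) := by
          rw [integral_sub iq (iz.const_mul μ), integral_const_mul, hz]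
          ring
      _ ≤ ∫ s, (2 * μ ^ 2 * w' s ^ 2 - C * w s ^ 2) := by
          refine integral_mono (iq.sub (iz.const_mul μ))
            ((i5.const_mul _).sub (i4.const_mul C)) fun s => ?_
          simp only
          nlinarith [sq_nonneg (T s * w s + 2 * μ * w' s)]
      _ = _ := by
          rw [integral_sub (i5.const_mul _) (i4.const_mul C), integral_const_mul,
            integral_const_mul, h1, hC]
          ring

/-- The Euclidean logarithmic Sobolev inequality on the line, in the form of a family of bounds
with parameter `θ`; optimizing over `θ` gives the sharp scale-invariant inequality. -/
theorem entropy_bound (H : SobolevLimit v v' w w') (h1 : ∫ s, w s ^ 2 = 1)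
    {θ ε : ℝ} (hθ : 0 < θ) (hε : 0 < ε) :
    ∃ q : ℝ → ℝ, Integrable q ∧ (∀ᵐ s, w s ^ 2 * Real.log (w s ^ 2) ≤ q s) ∧
      ∫ s, q s ≤ -(Real.log (2 * Real.pi) / 2) - 1 - Real.log θ / 2
        + 2 * θ * (∫ s, w' s ^ 2) + ε := by
  have hlim : Tendsto (fun N : ℝ => -Real.log (∫ t in -N..N, Real.exp (-(t ^ 2) / 2))) Filter.atTop
      (𝓝 (-(Real.log (2 * Real.pi) / 2))) := by
    rw [← Real.log_sqrt (by positivity)]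
    exact (tendsto_integral_truncated_gaussian.log (by positivity)).neg
  -- The loss ε pays for stopping at a finite N; the parameter of the truncated bound is then μ =
  -- √θ.
  obtain ⟨N, hN, hN0⟩ := ((hlim.eventually_lt_const (lt_add_of_pos_right _ hε)).and
    (eventually_gt_atTop 0)).exists
  obtain ⟨q, hq, hle, hint⟩ := H.entropy_bound_truncated h1 (Real.sqrt_pos.2 hθ) hN0
  refine ⟨q, hq, hle, hint.trans ?_⟩
  rw [Real.sq_sqrt hθ.le, Real.log_sqrt hθ.le]
  linarith

end SobolevLimit

/-! ### Test functions and their restriction to rays -/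

theorem IsTestFunction.continuous_gradient {d : ℕ} {φ : E d → ℝ} (hφ : IsTestFunction φ) :
    Continuous (gradient φ) :=
  (InnerProductSpace.toDual ℝ (E d)).symm.continuous.comp
    (hφ.contDiff.continuous_fderiv (by simp))

theorem IsTestFunction.hasCompactSupport_gradient {d : ℕ} {φ : E d → ℝ}
    (hφ : IsTestFunction φ) : HasCompactSupport (gradient φ) :=
  (hφ.hasCompactSupport.fderiv ℝ).comp_left
    (g := (InnerProductSpace.toDual ℝ (E d)).symm) (map_zero _)

/-- The gradient is bounded with compact support, and |x|^{-2a} is locally integrable at the origin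
because d - 2a > 2. Hence d = 1, where the support may contain 0, needs no separate treatment. -/
theorem IsTestFunction.lintegral_gradient_lt_top {d : ℕ} (hd : 1 ≤ d) {a : ℝ}
    (ha : a < ((d : ℝ) - 2) / 2) {φ : E d → ℝ} (hφ : IsTestFunction φ) :
    ∫⁻ x, ENNReal.ofReal (‖gradient φ x‖ ^ 2 / ‖x‖ ^ (2 * a)) < ⊤ := by
  obtain ⟨C, hC⟩ := hφ.hasCompactSupport_gradient.exists_bound_of_continuous
    hφ.continuous_gradient
  obtain ⟨R, hR0, hR⟩ := hφ.hasCompactSupport_gradient.isCompact.isBounded.exists_pos_norm_le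
  let K : ℝ → ENNReal := (Set.Iic (Real.log R)).indicator
    fun s => ENNReal.ofReal (C ^ 2 * Real.exp ((d - 2 * a) * s))
  have hK : Measurable K := Measurable.indicator (by fun_prop) measurableSet_Iic
  have hle : ∫⁻ x, ENNReal.ofReal (‖gradient φ x‖ ^ 2 / ‖x‖ ^ (2 * a)) ≤
      ∫⁻ x : E d, ENNReal.ofReal (‖x‖ ^ (-(d : ℝ))) * K (Real.log ‖x‖) := by
    refine lintegral_mono_ae ?_
    filter_upwards [norm_ne_zero_ae hd] with x hx
    by_cases hxs : x ∈ tsupport (gradient φ)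
    · have hlog : Real.log ‖x‖ ∈ Set.Iic (Real.log R) := Real.log_le_log hx (hR x hxs)
      simp only [K]
      rw [Set.indicator_of_mem hlog, ← ENNReal.ofReal_mul (by positivity)]
      refine ENNReal.ofReal_le_ofReal ?_
      have hexp : ‖x‖ ^ (-(d : ℝ)) * Real.exp ((d - 2 * a) * Real.log ‖x‖) =
          (‖x‖ ^ (2 * a))⁻¹ := by
        rw [mul_comm ((d : ℝ) - 2 * a), ← Real.rpow_def_of_pos hx, ← Real.rpow_add hx,
          ← Real.rpow_neg hx.le]
        congr 1
        ring
      rw [mul_left_comm, hexp, div_eq_mul_inv]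
      gcongr
      exact hC x
    · simp [image_eq_zero_of_notMem_tsupport hxs]
  refine hle.trans_lt ?_
  rw [lintegral_radial hd hK (Eventually.of_forall fun x => rfl),
    lintegral_indicator measurableSet_Iic]
  refine ENNReal.mul_lt_top ENNReal.ofReal_lt_top ?_
  have hi : IntegrableOn (fun s => C ^ 2 * Real.exp ((d - 2 * a) * s))
      (Set.Iic (Real.log R)) :=
    (integrableOn_exp_mul_Iic (by linarith) _).const_mul _
  exact hi.lintegral_lt_top

/-- G is at finite distance from the gradient of some test function. Finiteness matters because the
Bochner integral in `dirichletEnergy` would be 0 otherwise. -/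
theorem HasWeightedGradient.lintegral_gradient_lt_top {d : ℕ} (hd : 1 ≤ d) {a : ℝ}
    (ha : a < ((d : ℝ) - 2) / 2) {u : E d → ℝ} {G : E d → E d} (H : HasWeightedGradient a u G) :
    ∫⁻ x, ENNReal.ofReal (‖G x‖ ^ 2 / ‖x‖ ^ (2 * a)) < ⊤ := by
  obtain ⟨φ, hφ, h1, -⟩ := H.exists_seq
  obtain ⟨n, hn⟩ := (h1.eventually_lt_const ENNReal.zero_lt_top).exists
  have hle : ∫⁻ x, ENNReal.ofReal (‖G x‖ ^ 2 / ‖x‖ ^ (2 * a)) ≤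
      ∫⁻ x, ENNReal.ofReal 2 * (ENNReal.ofReal (‖gradient (φ n) x‖ ^ 2 / ‖x‖ ^ (2 * a)) +
        ENNReal.ofReal (‖gradient (φ n) x - G x‖ ^ 2 / ‖x‖ ^ (2 * a))) := by
    refine lintegral_mono fun x => ?_
    rw [← ENNReal.ofReal_add (by positivity) (by positivity),
      ← ENNReal.ofReal_mul (by norm_num), ← add_div, ← mul_div_assoc]
    refine ENNReal.ofReal_le_ofReal ?_
    gcongr
    have h := norm_sub_le (gradient (φ n) x) (gradient (φ n) x - G x)
    rw [sub_sub_cancel] at h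
    refine (pow_le_pow_left₀ (norm_nonneg _) h 2).trans ?_
    nlinarith [sq_nonneg (‖gradient (φ n) x‖ - ‖gradient (φ n) x - G x‖)]
  refine hle.trans_lt ?_
  have hm : Measurable fun x => ENNReal.ofReal (‖gradient (φ n) x‖ ^ 2 / ‖x‖ ^ (2 * a)) := by
    have := (hφ n).continuous_gradient.measurable
    fun_prop
  rw [lintegral_const_mul' _ _ (by simp), lintegral_add_left hm]
  exact ENNReal.mul_lt_top (by simp)
    (ENNReal.add_lt_top.2 ⟨(hφ n).lintegral_gradient_lt_top hd ha, hn⟩)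

theorem ofReal_exp_mul_ofReal_div {d : ℕ} (b : ℝ) (z : Metric.sphere (0 : E d) 1) (s X : ℝ) :
    ENNReal.ofReal (Real.exp (d * s)) *
      ENNReal.ofReal (X ^ 2 / ‖Real.exp s • (z : E d)‖ ^ (2 * b)) =
    ENNReal.ofReal ((Real.exp ((d - 2 * b) / 2 * s) * X) ^ 2) := by
  rw [norm_exp_smul, ← ENNReal.ofReal_mul (Real.exp_pos _).le, ← Real.exp_mul, mul_pow,
    ← Real.exp_nat_mul, mul_div_assoc', mul_div_right_comm, ← Real.exp_sub]
  congr 3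
  push_cast
  ring

/-- A test function along a ray, in logarithmic coordinates. -/
theorem hasDerivAt_exp_mul_comp_ray {d : ℕ} {φ : E d → ℝ} (hφ : IsTestFunction φ)
    (z : Metric.sphere (0 : E d) 1) (α s : ℝ) :
    HasDerivAt (fun s => Real.exp (α * s) * φ (Real.exp s • (z : E d)))
      (α * (Real.exp (α * s) * φ (Real.exp s • (z : E d))) +
        Real.exp ((α + 1) * s) * inner ℝ (gradient φ (Real.exp s • (z : E d))) z) s := by
  have h1 : HasDerivAt (fun s => Real.exp s • (z : E d)) (Real.exp s • (z : E d)) s :=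
    (Real.hasDerivAt_exp s).smul_const _
  have h2 : HasFDerivAt φ (InnerProductSpace.toDual ℝ (E d)
      (gradient φ (Real.exp s • (z : E d)))) (Real.exp s • (z : E d)) :=
    ((hφ.contDiff.differentiable (by simp)) _).hasGradientAt.hasFDerivAt
  have h3 := h2.comp_hasDerivAt s h1
  have h4 : HasDerivAt (fun s => Real.exp (α * s)) (Real.exp (α * s) * α) s := by
    simpa using ((hasDerivAt_id s).const_mul α).exp
  refine (h4.mul h3).congr_deriv ?_
  simp only [InnerProductSpace.toDual_apply_apply, inner_smul_right, Function.comp_apply]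
  rw [add_mul, Real.exp_add, one_mul]
  ring

theorem tendsto_exp_mul_comp_ray_atTop {d : ℕ} {φ : E d → ℝ} (hφ : IsTestFunction φ)
    (z : Metric.sphere (0 : E d) 1) (α : ℝ) :
    Tendsto (fun s => Real.exp (α * s) * φ (Real.exp s • (z : E d))) atTop (𝓝 0) := by
  obtain ⟨R, hR0, hR⟩ := hφ.hasCompactSupport.isCompact.isBounded.exists_pos_norm_le
  refine tendsto_const_nhds.congr' ?_
  filter_upwards [Real.tendsto_exp_atTop.eventually_gt_atTop R] with s hs
  have : Real.exp s • (z : E d) ∉ tsupport φ := fun h => by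
    have := hR _ h
    rw [norm_exp_smul] at this
    linarith
  rw [image_eq_zero_of_notMem_tsupport this, mul_zero]

/-- The decay comes from the exponential factor alone, since φ need not vanish near the origin when
d = 1. In the application α = (d-2-2a)/2, which is positive because a < (d-2)/2. -/
theorem tendsto_exp_mul_comp_ray_atBot {d : ℕ} {φ : E d → ℝ} (hφ : IsTestFunction φ)
    (z : Metric.sphere (0 : E d) 1) {α : ℝ} (hα : 0 < α) :
    Tendsto (fun s => Real.exp (α * s) * φ (Real.exp s • (z : E d))) atBot (𝓝 0) := by
  obtain ⟨C, hC⟩ := hφ.hasCompactSupport.exists_bound_of_continuous hφ.contDiff.continuous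
  have h : Tendsto (fun s => Real.exp (α * s) * C) atBot (𝓝 0) := by
    simpa using (Real.tendsto_exp_atBot.comp (tendsto_id.const_mul_atBot hα)).mul_const C
  refine squeeze_zero_norm (fun s => ?_) h
  rw [norm_mul, Real.norm_of_nonneg (Real.exp_pos _).le]
  exact mul_le_mul_of_nonneg_left (hC _) (Real.exp_pos _).le

theorem HasWeightedGradient.congr_ae {d : ℕ} {a : ℝ} {u u' : E d → ℝ} {G G' : E d → E d}
    (H : HasWeightedGradient a u G) (hu : u =ᵐ[volume] u') (hG : G =ᵐ[volume] G') :
    HasWeightedGradient a u' G' where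
  aestronglyMeasurable := H.aestronglyMeasurable.congr hu
  aestronglyMeasurable_gradient := H.aestronglyMeasurable_gradient.congr hG
  exists_seq := by
    obtain ⟨φ, hφ, h1, h2⟩ := H.exists_seq
    refine ⟨φ, hφ, h1.congr fun n => lintegral_congr_ae ?_,
      h2.congr fun n => lintegral_congr_ae ?_⟩
    · filter_upwards [hG] with x hx
      rw [hx]
    · filter_upwards [hu] with x hx
      rw [hx]

/-- Along almost every ray a subsequence of the approximating test functions converges; the ray can
be chosen so that the energy along it is at most the average over all rays. -/
theorem exists_good_ray {d : ℕ} (hd : 1 ≤ d) {a : ℝ} {f : ℝ → ℝ} {G : E d → E d}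
    (hf : Measurable f) (hG : Measurable G)
    (H : HasWeightedGradient a (fun x => f ‖x‖) G) :
    ∃ (z : Metric.sphere (0 : E d) 1) (φ : ℕ → E d → ℝ), (∀ n, IsTestFunction (φ n)) ∧
      (∀ n, (∫⁻ s : ℝ, ENNReal.ofReal ((Real.exp ((d - 2 * a) / 2 * s) *
          ‖gradient (φ n) (Real.exp s • (z : E d)) - G (Real.exp s • (z : E d))‖) ^ 2)) +
        ∫⁻ s : ℝ, ENNReal.ofReal ((Real.exp ((d - 2 * (a + 1)) / 2 * s) *
          (φ n (Real.exp s • (z : E d)) - f (Real.exp s))) ^ 2) < (n + 1 : ENNReal)⁻¹) ∧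
      ENNReal.ofReal (sphereArea d) * (∫⁻ s : ℝ, ENNReal.ofReal
          ((Real.exp ((d - 2 * a) / 2 * s) * ‖G (Real.exp s • (z : E d))‖) ^ 2)) ≤
        ∫⁻ x, ENNReal.ofReal (‖G x‖ ^ 2 / ‖x‖ ^ (2 * a)) := by
  have : Nonempty (Fin d) := ⟨⟨0, hd⟩⟩
  obtain ⟨φ, hφ, h1, h2⟩ := H.exists_seq
  have hφm : ∀ n, Measurable (φ n) := fun n => (hφ n).contDiff.continuous.measurable
  have hgm : ∀ n, Measurable (gradient (φ n)) := fun n => (hφ n).continuous_gradient.measurable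
  set A : ℕ → Metric.sphere (0 : E d) 1 → ENNReal := fun n z =>
    ∫⁻ s : ℝ, ENNReal.ofReal ((Real.exp ((d - 2 * a) / 2 * s) *
      ‖gradient (φ n) (Real.exp s • (z : E d)) - G (Real.exp s • (z : E d))‖) ^ 2) with hA
  set B : ℕ → Metric.sphere (0 : E d) 1 → ENNReal := fun n z =>
    ∫⁻ s : ℝ, ENNReal.ofReal ((Real.exp ((d - 2 * (a + 1)) / 2 * s) *
          (φ n (Real.exp s • (z : E d)) - f (Real.exp s))) ^ 2) with hB
  set e : Metric.sphere (0 : E d) 1 → ENNReal := fun z =>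
    ∫⁻ s : ℝ, ENNReal.ofReal
      ((Real.exp ((d - 2 * a) / 2 * s) * ‖G (Real.exp s • (z : E d))‖) ^ 2) with he
  have hAm : ∀ n, Measurable (A n) := fun n => Measurable.lintegral_prod_right' (f := fun p :
    Metric.sphere (0 : E d) 1 × ℝ => ENNReal.ofReal ((Real.exp ((d - 2 * a) / 2 * p.2) *
      ‖gradient (φ n) (Real.exp p.2 • (p.1 : E d)) - G (Real.exp p.2 • (p.1 : E d))‖) ^ 2)) (by
      have := hgm n
      fun_prop)
  have hBm : ∀ n, Measurable (B n) := fun n => Measurable.lintegral_prod_right' (f := fun p :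
    Metric.sphere (0 : E d) 1 × ℝ => ENNReal.ofReal ((Real.exp ((d - 2 * (a + 1)) / 2 * p.2) *
          (φ n (Real.exp p.2 • (p.1 : E d)) - f (Real.exp p.2))) ^ 2)) (by
      have := hφm n
      fun_prop)
  have hem : Measurable e := Measurable.lintegral_prod_right' (f := fun p :
    Metric.sphere (0 : E d) 1 × ℝ => ENNReal.ofReal
      ((Real.exp ((d - 2 * a) / 2 * p.2) * ‖G (Real.exp p.2 • (p.1 : E d))‖) ^ 2)) (by
      fun_prop)
  have hAi : ∀ n, ∫⁻ x, ENNReal.ofReal (‖gradient (φ n) x - G x‖ ^ 2 / ‖x‖ ^ (2 * a)) =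
      ∫⁻ z, A n z ∂(volume : Measure (E d)).toSphere := by
    intro n
    have := hgm n
    rw [lintegral_polar hd (by fun_prop)]
    simp only [ofReal_exp_mul_ofReal_div, hA]
  have hBi : ∀ n, ∫⁻ x, ENNReal.ofReal ((φ n x - f ‖x‖) ^ 2 / ‖x‖ ^ (2 * (a + 1))) =
      ∫⁻ z, B n z ∂(volume : Measure (E d)).toSphere := by
    intro n
    have := hφm n
    rw [lintegral_polar hd (by fun_prop)]
    simp only [ofReal_exp_mul_ofReal_div, hB]
    simp only [norm_exp_smul]
  have hei : ∫⁻ x, ENNReal.ofReal (‖G x‖ ^ 2 / ‖x‖ ^ (2 * a)) =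
      ∫⁻ z, e z ∂(volume : Measure (E d)).toSphere := by
    rw [lintegral_polar hd (by fun_prop)]
    simp only [ofReal_exp_mul_ofReal_div, he]
  have hlim : Tendsto (fun n => ∫⁻ z, (A n z + B n z) ∂(volume : Measure (E d)).toSphere)
      atTop (𝓝 0) := by
    have := h1.add h2
    rw [add_zero] at this
    refine this.congr fun n => ?_
    rw [hAi, hBi, lintegral_add_left (hAm n)]
  have hABm : ∀ n, Measurable fun z => A n z + B n z := fun n => (hAm n).add (hBm n)
  -- By Fatou, convergence of the spherical integrals to 0 forces the liminf to vanish on almost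
  -- every ray.
  have hfatou : ∫⁻ z, liminf (fun n => A n z + B n z) atTop
      ∂(volume : Measure (E d)).toSphere = 0 := by
    refine le_antisymm ?_ bot_le
    refine (lintegral_liminf_le hABm).trans ?_
    rw [hlim.liminf_eq]
  rw [lintegral_eq_zero_iff (Measurable.liminf hABm)] at hfatou
  -- One ray must serve both purposes: off the null set where the liminf is nonzero, the energy e is
  -- still somewhere at most its average.
  obtain ⟨z, hz, hze⟩ := exists_notMem_null_le_laverage
    (Measure.toSphere_ne_zero (volume : Measure (E d))) hem.aemeasurable (ae_iff.1 hfatou)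
  simp only [Pi.zero_apply, Set.mem_ofPred_eq, not_not] at hz
  -- The indices need not increase with k: the bound 1/(k+1) alone gives convergence.
  have hfreq : ∀ k : ℕ, ∃ n, A n z + B n z < (k + 1 : ENNReal)⁻¹ := by
    intro k
    refine (frequently_lt_of_liminf_lt (u := fun n => A n z + B n z) (f := atTop)
      (h := ?_)).exists
    rw [hz]
    simp
  choose n hn using hfreq
  refine ⟨z, fun k => φ (n k), fun k => hφ _, hn, ?_⟩
  rw [laverage_eq, toSphere_univ hd, ← hei] at hze
  calc _ ≤ ENNReal.ofReal (sphereArea d) * _ := mul_le_mul_right hze _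
    _ ≤ _ := ENNReal.mul_div_le

/-! ### Mass and entropy in the logarithmic variable -/

section Profile

variable {d : ℕ} {a : ℝ} {u : E d → ℝ} {w : ℝ → ℝ}

/-- `u(x) = |x|^{-(d-2-2a)/2} w(log |x|)` almost everywhere. -/
def HasProfile (a : ℝ) (u : E d → ℝ) (w : ℝ → ℝ) : Prop :=
  ∀ᵐ x : E d, u x = Real.exp (-(((d : ℝ) - 2 - 2 * a) / 2) * Real.log ‖x‖) * w (Real.log ‖x‖)

theorem exp_mul_log_eq_rpow {r : ℝ} (hr : 0 < r) (b : ℝ) : Real.exp (b * Real.log r) = r ^ b := by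
  rw [Real.rpow_def_of_pos hr, mul_comm]

theorem HasProfile.ae_sq_div (hd : 1 ≤ d) (h : HasProfile a u w) :
    ∀ᵐ x, u x ^ 2 / ‖x‖ ^ (2 * (a + 1)) = ‖x‖ ^ (-(d : ℝ)) * w (Real.log ‖x‖) ^ 2 := by
  filter_upwards [h, norm_ne_zero_ae hd] with x hx hx0
  rw [hx, exp_mul_log_eq_rpow hx0, mul_pow, ← Real.rpow_natCast, ← Real.rpow_mul hx0.le,
    mul_div_right_comm, ← Real.rpow_sub hx0]
  congr 2
  push_cast
  ring

/-- The weight |x|^{d-2-2a} inside the logarithm is exactly what cancels the square of the prefactor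
of w, so no explicit dependence on s is left beside w² log w². -/
theorem HasProfile.ae_logDensity (hd : 1 ≤ d) (h : HasProfile a u w) :
    ∀ᵐ x, logDensity a u x = ‖x‖ ^ (-(d : ℝ)) *
      (w (Real.log ‖x‖) ^ 2 * Real.log (w (Real.log ‖x‖) ^ 2)) := by
  filter_upwards [h, h.ae_sq_div hd, norm_ne_zero_ae hd] with x hx hx2 hx0
  rw [logDensity, hx2, mul_assoc]
  congr 3
  rw [hx, exp_mul_log_eq_rpow hx0, mul_pow, ← Real.rpow_natCast, ← Real.rpow_mul hx0.le,
    ← mul_assoc, ← Real.rpow_add hx0]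
  convert one_mul _
  convert Real.rpow_zero _
  push_cast
  ring

theorem lintegral_ofReal_radial (hd : 1 ≤ d) {k : ℝ → ℝ} (hk : Measurable k) {F : E d → ℝ}
    (hF : ∀ᵐ x, F x = ‖x‖ ^ (-(d : ℝ)) * k (Real.log ‖x‖)) :
    ∫⁻ x, ENNReal.ofReal (F x) = ∫⁻ s, ENNReal.ofReal (sphereArea d * k s) := by
  rw [lintegral_radial hd (K := fun s => ENNReal.ofReal (k s)) hk.ennreal_ofReal,
    ← lintegral_const_mul _ hk.ennreal_ofReal]
  · simp only [ENNReal.ofReal_mul (sphereArea_pos hd).le]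
  · filter_upwards [hF] with x hx
    rw [hx, ENNReal.ofReal_mul (by positivity)]

theorem HasProfile.weightedMass_eq (hd : 1 ≤ d) (hw : Measurable w) (h : HasProfile a u w) :
    weightedMass a u = sphereArea d * ∫ s, w s ^ 2 := by
  have hS := (sphereArea_pos hd).le
  have hm : AEStronglyMeasurable (fun x => u x ^ 2 / ‖x‖ ^ (2 * (a + 1))) volume := by
    refine AEStronglyMeasurable.congr (f := fun x => ‖x‖ ^ (-(d : ℝ)) * w (Real.log ‖x‖) ^ 2)
      (Measurable.aestronglyMeasurable (by fun_prop)) ?_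
    filter_upwards [h.ae_sq_div hd] with x hx using hx.symm
  rw [weightedMass, integral_eq_lintegral_of_nonneg_ae (Eventually.of_forall fun x => by
    simp only [Pi.zero_apply]; positivity) hm,
    lintegral_ofReal_radial hd (hw.pow_const 2) (h.ae_sq_div hd), ← integral_const_mul,
    integral_eq_lintegral_of_nonneg_ae (Eventually.of_forall fun x => by
      simp only [Pi.zero_apply]; positivity) (Measurable.aestronglyMeasurable (by fun_prop))]

theorem HasProfile.lintegral_logDensity (hd : 1 ≤ d) (hw : Measurable w) (h : HasProfile a u w) :
    ∫⁻ x, ENNReal.ofReal (logDensity a u x) =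
      ∫⁻ s, ENNReal.ofReal (sphereArea d * (w s ^ 2 * Real.log (w s ^ 2))) :=
  lintegral_ofReal_radial hd (by fun_prop) (h.ae_logDensity hd)

theorem HasProfile.lintegral_neg_logDensity (hd : 1 ≤ d) (hw : Measurable w)
    (h : HasProfile a u w) :
    ∫⁻ x, ENNReal.ofReal (-logDensity a u x) =
      ∫⁻ s, ENNReal.ofReal (-(sphereArea d * (w s ^ 2 * Real.log (w s ^ 2)))) := by
  have hneg : ∀ s, -(sphereArea d * (w s ^ 2 * Real.log (w s ^ 2))) =
      sphereArea d * -(w s ^ 2 * Real.log (w s ^ 2)) := fun s => (mul_neg _ _).symm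
  simp only [hneg]
  refine lintegral_ofReal_radial (k := fun s => -(w s ^ 2 * Real.log (w s ^ 2))) hd
    (by fun_prop) ?_
  filter_upwards [h.ae_logDensity hd] with x hx
  rw [hx, mul_neg]

end Profile

/-! ### From radial elements of the completion to H¹(ℝ) -/

/-- Serves to pass from w to √S w, whose square has integral one. -/
theorem SobolevLimit.const_mul {v v' : ℕ → ℝ → ℝ} {w w' : ℝ → ℝ} (H : SobolevLimit v v' w w')
    (c : ℝ) : SobolevLimit (fun n s => c * v n s) (fun n s => c * v' n s) (fun s => c * w s)
      (fun s => c * w' s) where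
  hasDerivAt n s := (H.hasDerivAt n s).const_mul c
  memLp n := (H.memLp n).const_mul c
  memLp_deriv n := (H.memLp_deriv n).const_mul c
  atBot n := by simpa using (H.atBot n).const_mul c
  atTop n := by simpa using (H.atTop n).const_mul c
  memLp_limit := H.memLp_limit.const_mul c
  memLp_limit_deriv := H.memLp_limit_deriv.const_mul c
  tendsto := by
    have h := ENNReal.Tendsto.const_mul (a := ‖c‖ₑ) H.tendsto (Or.inr enorm_ne_top)
    rw [mul_zero] at h
    refine h.congr fun n => ?_
    rw [← eLpNorm_const_smul]
    congr 1
    ext s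
    simp [mul_sub]
  tendsto_deriv := by
    have h := ENNReal.Tendsto.const_mul (a := ‖c‖ₑ) H.tendsto_deriv (Or.inr enorm_ne_top)
    rw [mul_zero] at h
    refine h.congr fun n => ?_
    rw [← eLpNorm_const_smul]
    congr 1
    ext s
    simp [mul_sub]

theorem SobolevLimit.integral_mul_eq_zero {v v' : ℕ → ℝ → ℝ} {w w' : ℝ → ℝ}
    (H : SobolevLimit v v' w w') : ∫ s, w' s * w s = 0 := by
  have := H.integral_mul_deriv_eq_zero (T := fun _ => 1) (T' := fun _ => 0) (A := 1) (B := 0)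
    (fun s => hasDerivAt_const s 1) (by simp) continuous_const (by simp)
  simpa [integral_const_mul] using this

theorem tendsto_inv_nat_add_one : Tendsto (fun n : ℕ => (n + 1 : ENNReal)⁻¹) atTop (𝓝 0) := by
  have h := (tendsto_add_atTop_iff_nat 1).2 ENNReal.tendsto_inv_nat_nhds_zero
  simpa using h

/-- A radial element of `𝒟^{1,2}_a` is, in logarithmic coordinates, an element of the Sobolev space
`H¹(ℝ)`, and the energy is bounded below by the transformed energy. -/
theorem HasWeightedGradient.exists_profile {d : ℕ} (hd : 1 ≤ d) {a : ℝ}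
    (ha : a < ((d : ℝ) - 2) / 2) {u : E d → ℝ} {G : E d → E d}
    (H : HasWeightedGradient a u G) (hr : IsRadial u) (hm : weightedMass a u = 1) :
    ∃ (w h : ℝ → ℝ) (v v' : ℕ → ℝ → ℝ), Measurable w ∧ HasProfile a u w ∧
      SobolevLimit v v' w h ∧
      sphereArea d * (∫ s, h s ^ 2) + (((d : ℝ) - 2 - 2 * a) / 2) ^ 2 *
        (sphereArea d * ∫ s, w s ^ 2) ≤ dirichletEnergy a G := by
  have hS := sphereArea_pos hd
  obtain ⟨f, hf, huf⟩ := hr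
  obtain ⟨G', hG'm, hGG'⟩ := H.aestronglyMeasurable_gradient
  have hG' := hG'm.measurable
  have H' := H.congr_ae huf hGG'
  set α : ℝ := ((d : ℝ) - 2 - 2 * a) / 2 with hα
  have hα0 : 0 < α := by rw [hα]; linarith
  have e1 : ((d : ℝ) - 2 * a) / 2 = α + 1 := by rw [hα]; ring
  have e2 : ((d : ℝ) - 2 * (a + 1)) / 2 = α := by rw [hα]; ring
  obtain ⟨z, φ, hφ, hconv, hen⟩ := exists_good_ray hd hf hG' H'
  rw [e1, e2] at hconv
  rw [e1] at hen
  have hEfin := H'.lintegral_gradient_lt_top hd ha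
  have hEeq : dirichletEnergy a G =
      (∫⁻ x, ENNReal.ofReal (‖G' x‖ ^ 2 / ‖x‖ ^ (2 * a))).toReal := by
    rw [← integral_eq_lintegral_of_nonneg_ae (Eventually.of_forall fun x => by
      simp only [Pi.zero_apply]; positivity)
      (Measurable.aestronglyMeasurable (by fun_prop)), dirichletEnergy]
    refine integral_congr_ae ?_
    filter_upwards [hGG'] with x hx
    rw [hx]
  set w : ℝ → ℝ := fun s => Real.exp (α * s) * f (Real.exp s) with hw
  -- The radial component of the gradient along the chosen ray. The weak derivative of w will be α w
  -- + p, and p² is at most the weighted |G'|² by Cauchy–Schwarz.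
  set p : ℝ → ℝ := fun s =>
    Real.exp ((α + 1) * s) * inner ℝ (G' (Real.exp s • (z : E d))) (z : E d) with hp
  have hwm : Measurable w := by fun_prop
  have hpm : Measurable p := by
    have : Measurable fun s : ℝ => G' (Real.exp s • (z : E d)) := hG'.comp (by fun_prop)
    fun_prop
  have hprof : HasProfile a u w := by
    filter_upwards [huf, norm_ne_zero_ae hd] with x hx hx0
    rw [hx, hw]
    simp only
    rw [Real.exp_log hx0, ← mul_assoc, ← Real.exp_add, ← hα]
    simp
  have hwmass : sphereArea d * ∫ s, w s ^ 2 = 1 := by rw [← hprof.weightedMass_eq hd hwm, hm]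
  have hwi : Integrable fun s => w s ^ 2 := by
    -- If w² were not integrable, its Bochner integral would be 0, contradicting unit mass.
    by_contra hc
    rw [integral_undef hc] at hwmass
    simp at hwmass
  have hwL : MemLp w 2 volume := (memLp_two_iff_integrable_sq hwm.aestronglyMeasurable).2 hwi
  have hinner : ∀ y : E d, inner ℝ y (z : E d) ^ 2 ≤ ‖y‖ ^ 2 := by
    intro y
    have h := abs_real_inner_le_norm y (z : E d)
    rw [norm_eq_of_mem_sphere z, mul_one] at h
    exact sq_le_sq.2 (by rwa [abs_of_nonneg (norm_nonneg y)])
  have hinner' : ∀ (s : ℝ) (y : E d), (Real.exp ((α + 1) * s) * inner ℝ y (z : E d)) ^ 2 ≤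
      (Real.exp ((α + 1) * s) * ‖y‖) ^ 2 := by
    intro s y
    rw [mul_pow, mul_pow]
    exact mul_le_mul_of_nonneg_left (hinner y) (sq_nonneg _)
  have hp_le : ENNReal.ofReal (sphereArea d) * ∫⁻ s, ENNReal.ofReal (p s ^ 2) ≤
      ∫⁻ x, ENNReal.ofReal (‖G' x‖ ^ 2 / ‖x‖ ^ (2 * a)) := by
    refine le_trans (mul_le_mul_right (lintegral_mono fun s => ?_) _) hen
    exact ENNReal.ofReal_le_ofReal (hinner' s _)
  have hpfin : ∫⁻ s, ENNReal.ofReal (p s ^ 2) < ⊤ := by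
    refine lt_top_iff_ne_top.2 fun h => ?_
    rw [h, ENNReal.mul_top (by simpa using hS)] at hp_le
    exact absurd hEfin (by simpa using hp_le)
  have hpL : MemLp p 2 volume :=
    memLp_two_of_lintegral_lt_top hpm.aestronglyMeasurable hpfin
  set v : ℕ → ℝ → ℝ := fun n s => Real.exp (α * s) * φ n (Real.exp s • (z : E d)) with hv
  set P : ℕ → ℝ → ℝ := fun n s => Real.exp ((α + 1) * s) *
    inner ℝ (gradient (φ n) (Real.exp s • (z : E d))) (z : E d) with hP
  have hvc : ∀ n, Continuous (v n) := fun n => by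
    have := (hφ n).contDiff.continuous
    fun_prop
  have hPc : ∀ n, Continuous (P n) := fun n => by
    have := (hφ n).continuous_gradient
    fun_prop
  have hvw : ∀ n, ∫⁻ s, ENNReal.ofReal ((v n s - w s) ^ 2) < (n + 1 : ENNReal)⁻¹ := by
    intro n
    refine lt_of_le_of_lt ?_ (hconv n)
    refine le_trans (lintegral_mono fun s => ?_) le_add_self
    rw [hv, hw]
    simp only [mul_sub]
    exact le_rfl
  have hPp : ∀ n, ∫⁻ s, ENNReal.ofReal ((P n s - p s) ^ 2) < (n + 1 : ENNReal)⁻¹ := by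
    intro n
    refine lt_of_le_of_lt ?_ (hconv n)
    refine le_trans (lintegral_mono fun s => ?_) le_self_add
    rw [hP, hp]
    simp only [← mul_sub, ← inner_sub_left]
    exact ENNReal.ofReal_le_ofReal (hinner' s _)
  have hinv : ∀ n : ℕ, (n + 1 : ENNReal)⁻¹ < ⊤ := fun n => by simp
  have hvwL : ∀ n, MemLp (v n - w) 2 volume := fun n =>
    memLp_two_of_lintegral_lt_top ((hvc n).aestronglyMeasurable.sub hwm.aestronglyMeasurable)
      ((hvw n).trans (hinv n))
  have hPpL : ∀ n, MemLp (P n - p) 2 volume := fun n =>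
    memLp_two_of_lintegral_lt_top ((hPc n).aestronglyMeasurable.sub hpm.aestronglyMeasurable)
      ((hPp n).trans (hinv n))
  have hvL : ∀ n, MemLp (v n) 2 volume := fun n => by simpa using (hvwL n).add hwL
  have hPL : ∀ n, MemLp (P n) 2 volume := fun n => by simpa using (hPpL n).add hpL
  have hvt : Tendsto (fun n => eLpNorm (v n - w) 2 volume) atTop (𝓝 0) :=
    tendsto_eLpNorm_two (tendsto_of_tendsto_of_tendsto_of_le_of_le tendsto_const_nhds
      tendsto_inv_nat_add_one (fun _ => bot_le) fun n => (hvw n).le)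
  have hPt : Tendsto (fun n => eLpNorm (P n - p) 2 volume) atTop (𝓝 0) :=
    tendsto_eLpNorm_two (tendsto_of_tendsto_of_tendsto_of_le_of_le tendsto_const_nhds
      tendsto_inv_nat_add_one (fun _ => bot_le) fun n => (hPp n).le)
  have hSL : SobolevLimit v (fun n s => α * v n s + P n s) w (fun s => α * w s + p s) :=
    { hasDerivAt := fun n s => hasDerivAt_exp_mul_comp_ray (hφ n) z α s
      memLp := hvL
      memLp_deriv := fun n => ((hvL n).const_mul α).add (hPL n)
      atBot := fun n => tendsto_exp_mul_comp_ray_atBot (hφ n) z hα0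
      atTop := fun n => tendsto_exp_mul_comp_ray_atTop (hφ n) z α
      memLp_limit := hwL
      memLp_limit_deriv := (hwL.const_mul α).add hpL
      tendsto := hvt
      tendsto_deriv := by
        have hlim : Tendsto (fun n => ‖α‖ₑ * eLpNorm (v n - w) 2 volume +
            eLpNorm (P n - p) 2 volume) atTop (𝓝 0) := by
          simpa using (ENNReal.Tendsto.const_mul (a := ‖α‖ₑ) hvt (Or.inr enorm_ne_top)).add hPt
        refine tendsto_of_tendsto_of_tendsto_of_le_of_le tendsto_const_nhds hlim
          (fun _ => bot_le) fun n => ?_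
        have hsplit : ((fun s => α * v n s + P n s) - fun s => α * w s + p s) =
            α • (v n - w) + (P n - p) := by
          ext s
          simp only [Pi.sub_apply, Pi.add_apply, Pi.smul_apply, smul_eq_mul]
          ring
        simp only [hsplit]
        refine (eLpNorm_add_le ((hvwL n).const_smul α).aestronglyMeasurable
          (hPpL n).aestronglyMeasurable (by norm_num)).trans ?_
        rw [eLpNorm_const_smul] }
  refine ⟨w, _, v, _, hwm, hprof, hSL, ?_⟩
  have hz := hSL.integral_mul_eq_zero
  have i1 : Integrable fun s => (α * w s + p s) ^ 2 := hSL.memLp_limit_deriv.integrable_sq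
  have i2 : Integrable fun s => (α * w s + p s) * w s := hSL.memLp_limit_deriv.integrable_mul hwL
  -- Expand p = h - α w with h = α w + p; the cross term vanishes since ∫ h w = 0. This is the
  -- source of the Hardy term α² ∫ w².
  have hident : ∫ s, p s ^ 2 = (∫ s, (α * w s + p s) ^ 2) + α ^ 2 * ∫ s, w s ^ 2 := by
    have h : ∀ s, p s ^ 2 = (α * w s + p s) ^ 2 + α ^ 2 * w s ^ 2
        - 2 * α * ((α * w s + p s) * w s) := fun s => by ring
    have i3 : Integrable fun s => (α * w s + p s) ^ 2 + α ^ 2 * w s ^ 2 :=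
      i1.add (hwi.const_mul _)
    simp only [h]
    rw [integral_sub i3 (i2.const_mul _),
      integral_add i1 (hwi.const_mul _), integral_const_mul, integral_const_mul, hz]
    ring
  have hfinal := ENNReal.toReal_mono hEfin.ne hp_le
  rw [← hEeq, ENNReal.toReal_mul, ENNReal.toReal_ofReal hS.le,
    ← integral_eq_lintegral_of_nonneg_ae (Eventually.of_forall fun x => by
      simp only [Pi.zero_apply]; positivity)
      hpL.integrable_sq.aestronglyMeasurable, hident] at hfinal
  linarith

/-! ### The inequality and the choice of the parameter -/

/-- The majorant makes the positive part finite. If the negative part is infinite the difference is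
-∞; otherwise k is integrable and monotonicity applies. -/
theorem lintegral_sub_lintegral_le {α : Type*} [MeasurableSpace α] {μ : Measure α}
    {k q : α → ℝ} (hk : AEStronglyMeasurable k μ) (hq : Integrable q μ) (hkq : ∀ᵐ x ∂μ, k x ≤ q x) :
    (∫⁻ x, ENNReal.ofReal (k x) ∂μ) < ⊤ ∧
      ((∫⁻ x, ENNReal.ofReal (k x) ∂μ : ENNReal) : EReal)
        - ((∫⁻ x, ENNReal.ofReal (-k x) ∂μ : ENNReal) : EReal) ≤ ((∫ x, q x ∂μ : ℝ) : EReal) := by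
  have hfin : (∫⁻ x, ENNReal.ofReal (k x) ∂μ) < ⊤ := by
    refine lt_of_le_of_lt (lintegral_mono_ae ?_) hq.lintegral_lt_top
    filter_upwards [hkq] with x hx using ENNReal.ofReal_le_ofReal hx
  refine ⟨hfin, ?_⟩
  by_cases hneg : (∫⁻ x, ENNReal.ofReal (-k x) ∂μ) = ⊤
  · rw [hneg, EReal.coe_ennreal_top, EReal.sub_top]
    exact bot_le
  have hki : Integrable k μ := by
    refine ⟨hk, ?_⟩
    rw [hasFiniteIntegral_iff_norm]
    have hle : ∫⁻ x, ENNReal.ofReal ‖k x‖ ∂μ ≤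
        ∫⁻ x, (ENNReal.ofReal (k x) + ENNReal.ofReal (-k x)) ∂μ := by
      refine lintegral_mono fun x => ?_
      rcases le_total 0 (k x) with h | h
      · rw [Real.norm_of_nonneg h]
        exact le_self_add
      · rw [Real.norm_of_nonpos h]
        exact le_add_self
    refine hle.trans_lt ?_
    rw [lintegral_add_left' hk.aemeasurable.ennreal_ofReal]
    exact ENNReal.add_lt_top.2 ⟨hfin, lt_top_iff_ne_top.2 hneg⟩
  have h := integral_mono_ae hki hq hkq
  rw [integral_eq_lintegral_pos_part_sub_lintegral_neg_part hki] at h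
  rw [← EReal.coe_ennreal_toReal hfin.ne, ← EReal.coe_ennreal_toReal hneg, ← EReal.coe_sub]
  exact_mod_cast h

theorem lintegral_sub_lintegral_eq_integral {α : Type*} [MeasurableSpace α] {μ : Measure α}
    {f : α → ℝ} (hf : Integrable f μ) :
    ((∫⁻ x, ENNReal.ofReal (f x) ∂μ : ENNReal) : EReal)
      - ((∫⁻ x, ENNReal.ofReal (-f x) ∂μ : ENNReal) : EReal) = ((∫ x, f x ∂μ : ℝ) : EReal) := by
  have hneg : (∫⁻ x, ENNReal.ofReal (-f x) ∂μ) ≠ ⊤ := hf.neg.lintegral_lt_top.ne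
  rw [integral_eq_lintegral_pos_part_sub_lintegral_neg_part hf, EReal.coe_sub,
    EReal.coe_ennreal_toReal hf.lintegral_lt_top.ne, EReal.coe_ennreal_toReal hneg]

theorem log_sphereArea {d : ℕ} (hd : 1 ≤ d) : Real.log (sphereArea d) =
    Real.log 2 + (d : ℝ) / 2 * Real.log Real.pi - Real.log (Real.Gamma ((d : ℝ) / 2)) := by
  have h0 : (0 : ℝ) < d := by exact_mod_cast hd
  have hΓ := Real.Gamma_pos_of_pos (half_pos h0)
  rw [sphereArea, Real.log_div (by positivity) hΓ.ne', Real.log_mul (by norm_num) (by positivity),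
    Real.log_rpow Real.pi_pos]

theorem logHardyConst_pos {d : ℕ} (hd : 1 ≤ d) {a γ : ℝ} (ha : a < ((d : ℝ) - 2) / 2)
    (hγ : 1 / 4 ≤ γ) : 0 < logHardyConst d a γ := by
  have h0 : (0 : ℝ) < d := by exact_mod_cast hd
  have hΓ := Real.Gamma_pos_of_pos (half_pos h0)
  have hc : 0 < (d : ℝ) - 2 - 2 * a := by linarith
  unfold logHardyConst
  split_ifs with h
  · positivity
  · have h1 : 0 < 4 * γ - 1 := by
      have := lt_of_le_of_ne hγ (Ne.symm h)
      linarith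
    positivity

/-- After multiplication by 2γ the logarithm has one formula for both branches, since the
coefficient 2γ - 1/2 vanishes at γ = 1/4. -/
theorem two_mul_log_logHardyConst {d : ℕ} (hd : 1 ≤ d) {a γ : ℝ} (ha : a < ((d : ℝ) - 2) / 2)
    (hγ : 1 / 4 ≤ γ) : 2 * γ * Real.log (logHardyConst d a γ) =
      -(2 * γ) * Real.log γ + Real.log (Real.Gamma ((d : ℝ) / 2))
      - (3 * Real.log 2 + (d + 1) * Real.log Real.pi + 1) / 2
      + (2 * γ - 1 / 2) * Real.log ((4 * γ - 1) / ((d : ℝ) - 2 - 2 * a) ^ 2) := by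
  have h0 : (0 : ℝ) < d := by exact_mod_cast hd
  have hΓ := Real.Gamma_pos_of_pos (half_pos h0)
  have hc : 0 < (d : ℝ) - 2 - 2 * a := by linarith
  have hγ0 : 0 < γ := by linarith
  have h8 : Real.log (8 * Real.pi ^ (d + 1) * Real.exp 1) =
      3 * Real.log 2 + (d + 1) * Real.log Real.pi + 1 := by
    rw [Real.log_mul (by positivity) (by positivity), Real.log_mul (by norm_num) (by positivity),
      Real.log_exp, Real.log_pow, show (8 : ℝ) = 2 ^ 3 by norm_num, Real.log_pow]
    push_cast
    ring
  unfold logHardyConst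
  split_ifs with h
  · rw [Real.log_mul (by norm_num) (by positivity), Real.log_div (by positivity) (by positivity),
      h8, Real.log_pow, h, Real.log_div one_ne_zero (by norm_num), Real.log_one]
    push_cast
    ring
  · have h1 : 0 < 4 * γ - 1 := by
      have := lt_of_le_of_ne hγ (Ne.symm h)
      linarith
    rw [Real.log_mul (by positivity) (by positivity), Real.log_mul (by positivity) (by positivity),
      Real.log_div one_ne_zero hγ0.ne', Real.log_one, Real.log_div (by positivity) (by positivity),
      Real.log_rpow (by positivity), Real.log_rpow (by positivity), Real.log_rpow (by positivity),
      h8]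
    field_simp
    ring

/-- Optimization of the logarithmic Sobolev bound over the scaling parameter. -/
theorem entropy_bound_le_log {d : ℕ} (hd : 1 ≤ d) {a γ D K : ℝ} (ha : a < ((d : ℝ) - 2) / 2)
    (hγ : 1 / 4 ≤ γ) (hK0 : 0 < K) (hDK : D + (((d : ℝ) - 2 - 2 * a) / 2) ^ 2 ≤ K) :
    -(Real.log (2 * Real.pi) / 2) - 1 - Real.log (γ / K) / 2 + 2 * (γ / K) * D
      - Real.log (sphereArea d) ≤ 2 * γ * Real.log (logHardyConst d a γ * K) := by
  have hC := logHardyConst_pos hd ha hγ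
  have hγ0 : 0 < γ := by linarith
  set c := (d : ℝ) - 2 - 2 * a with hc
  have hc0 : 0 < c := by rw [hc]; linarith
  have hD : 2 * (γ / K) * D ≤ 2 * γ - γ * c ^ 2 / (2 * K) := by
    have : 2 * (γ / K) * D ≤ 2 * (γ / K) * (K - (c / 2) ^ 2) :=
      mul_le_mul_of_nonneg_left (by linarith) (by positivity)
    refine this.trans_eq ?_
    field_simp
  -- For γ > 1/4 this is log y ≤ y - 1 at y = γc²/((4γ-1)K), with equality at K = γc²/(4γ-1), the
  -- energy of the extremal. For γ = 1/4 only a positive term remains.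
  have hkey : 0 ≤ (2 * γ - 1 / 2) * (Real.log ((4 * γ - 1) / c ^ 2) + Real.log K - Real.log γ - 1)
      + γ * c ^ 2 / (2 * K) := by
    rcases hγ.eq_or_lt with h | h
    · rw [← h]
      norm_num
      positivity
    · have h1 : 0 < 4 * γ - 1 := by linarith
      have hy : 0 < γ * c ^ 2 / ((4 * γ - 1) * K) := by positivity
      have hl := Real.log_le_sub_one_of_pos hy
      rw [Real.log_div (by positivity) (by positivity), Real.log_mul (by positivity)
        (by positivity), Real.log_mul (by positivity) (by positivity)] at hl
      rw [Real.log_div (by positivity) (by positivity)]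
      have hm := mul_le_mul_of_nonneg_left hl (by linarith : 0 ≤ 2 * γ - 1 / 2)
      have he : (2 * γ - 1 / 2) * (γ * c ^ 2 / ((4 * γ - 1) * K) - 1) =
          γ * c ^ 2 / (2 * K) - (2 * γ - 1 / 2) := by
        rw [show 2 * γ - 1 / 2 = (4 * γ - 1) / 2 by ring]
        generalize 4 * γ - 1 = m at h1
        field_simp
      rw [he] at hm
      linarith
  rw [Real.log_mul hC.ne' hK0.ne', mul_add, two_mul_log_logHardyConst hd ha hγ, ← hc,
    log_sphereArea hd, Real.log_mul (by norm_num) Real.pi_pos.ne',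
    Real.log_div hγ0.ne' hK0.ne']
  linarith

theorem ereal_le_of_forall_pos {x : EReal} {b : ℝ}
    (h : ∀ ε : ℝ, 0 < ε → x ≤ ((b + ε : ℝ) : EReal)) : x ≤ (b : EReal) := by
  by_contra! hlt
  obtain ⟨r, hr1, hr2⟩ := EReal.lt_iff_exists_real_btwn.1 hlt
  have hbr : b < r := by exact_mod_cast hr1
  have := h (r - b) (by linarith)
  rw [add_sub_cancel] at this
  exact absurd hr2 (not_lt.2 this)

/-- The logarithmic Hardy inequality for radial functions. -/
theorem HasWeightedGradient.log_hardy {d : ℕ} (hd : 1 ≤ d) {a γ : ℝ}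
    (ha : a < ((d : ℝ) - 2) / 2) (hγ : 1 / 4 ≤ γ) {u : E d → ℝ} {G : E d → E d}
    (H : HasWeightedGradient a u G) (hr : IsRadial u) (hm : weightedMass a u = 1) :
    (∫⁻ x, ENNReal.ofReal (logDensity a u x)) < ⊤ ∧
      extIntegral (logDensity a u) ≤
        ((2 * γ * Real.log (logHardyConst d a γ * dirichletEnergy a G) : ℝ) : EReal) := by
  obtain ⟨w, h, v, v', hwm, hprof, hSL, hen⟩ := H.exists_profile hd ha hr hm
  have hS := sphereArea_pos hd
  have hmass : sphereArea d * ∫ s, w s ^ 2 = 1 := by rw [← hprof.weightedMass_eq hd hwm, hm]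
  rw [hmass, mul_one] at hen
  have hsq : ∀ x : ℝ, (√(sphereArea d) * x) ^ 2 = sphereArea d * x ^ 2 := fun x => by
    rw [mul_pow, Real.sq_sqrt hS.le]
  have hSL' := hSL.const_mul √(sphereArea d)
  have h1 : ∫ s, (√(sphereArea d) * w s) ^ 2 = 1 := by
    simp only [hsq, integral_const_mul, hmass]
  have hwi := hSL.memLp_limit.integrable_sq
  have hD0 : 0 ≤ sphereArea d * ∫ s, h s ^ 2 :=
    mul_nonneg hS.le (integral_nonneg fun s => sq_nonneg _)
  have hK0 : 0 < dirichletEnergy a G := by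
    have : 0 < (((d : ℝ) - 2 - 2 * a) / 2) ^ 2 := by
      have : 0 < (d : ℝ) - 2 - 2 * a := by linarith
      positivity
    linarith
  -- With D the transformed derivative energy, the best parameter would be 1/(4D). The choice γ/K
  -- agrees with it on the extremal, where K = γc²/(4γ-1) and D = c²/(4(4γ-1)), and requires no
  -- positivity of D.
  have hθ : 0 < γ / dirichletEnergy a G := div_pos (by linarith) hK0
  have hmain : ∀ ε : ℝ, 0 < ε → (∫⁻ x, ENNReal.ofReal (logDensity a u x)) < ⊤ ∧
      extIntegral (logDensity a u) ≤
        ((2 * γ * Real.log (logHardyConst d a γ * dirichletEnergy a G) + ε : ℝ) : EReal) := by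
    intro ε hε
    obtain ⟨q, hq, hle, hint⟩ := hSL'.entropy_bound h1 hθ hε
    have hq' : Integrable fun s => q s - Real.log (sphereArea d) * (sphereArea d * w s ^ 2) :=
      hq.sub ((hwi.const_mul _).const_mul _)
    have hk : Measurable fun s => sphereArea d * (w s ^ 2 * Real.log (w s ^ 2)) := by fun_prop
    have hkq : ∀ᵐ s, sphereArea d * (w s ^ 2 * Real.log (w s ^ 2)) ≤
        q s - Real.log (sphereArea d) * (sphereArea d * w s ^ 2) := by
      filter_upwards [hle] with s hs
      rcases eq_or_ne (w s) 0 with h0 | h0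
      · simpa [h0] using hs
      · rw [hsq, Real.log_mul hS.ne' (by positivity)] at hs
        linarith
    obtain ⟨r1, r2⟩ := lintegral_sub_lintegral_le hk.aestronglyMeasurable hq' hkq
    rw [extIntegral, hprof.lintegral_logDensity hd hwm, hprof.lintegral_neg_logDensity hd hwm]
    refine ⟨r1, r2.trans ?_⟩
    rw [EReal.coe_le_coe_iff, integral_sub hq ((hwi.const_mul _).const_mul _),
      integral_const_mul, integral_const_mul, hmass, mul_one]
    simp only [hsq, integral_const_mul] at hint
    have := entropy_bound_le_log hd ha hγ hK0 hen
    linarith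
  exact ⟨(hmain 1 one_pos).1, ereal_le_of_forall_pos fun ε hε => (hmain ε hε).2⟩

/-! ### Gaussian moments -/

section GaussianMoments

variable {b : ℝ}

theorem integrable_mul_exp_neg_mul_sq' (hb : 0 < b) :
    Integrable fun s : ℝ => s * Real.exp (-b * s ^ 2) := by
  simpa using integrable_mul_exp_neg_mul_sq hb

theorem integrable_sq_mul_exp_neg_mul_sq (hb : 0 < b) :
    Integrable fun s : ℝ => s ^ 2 * Real.exp (-b * s ^ 2) := by
  have := integrable_rpow_mul_exp_neg_mul_sq hb (s := 2) (by norm_num)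
  simpa using this

theorem integral_mul_exp_neg_mul_sq (b : ℝ) : ∫ s : ℝ, s * Real.exp (-b * s ^ 2) = 0 := by
  have h := integral_neg_eq_self (fun s : ℝ => s * Real.exp (-b * s ^ 2)) volume
  simp only [neg_sq, neg_mul, integral_neg] at h ⊢
  linarith

/-- The derivative of s exp(-b s²) has integral zero, which reduces the second moment to the
Gaussian integral. -/
theorem integral_sq_mul_exp_neg_mul_sq (hb : 0 < b) :
    ∫ s : ℝ, s ^ 2 * Real.exp (-b * s ^ 2) = √(Real.pi / b) / (2 * b) := by
  have i0 := integrable_exp_neg_mul_sq hb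
  have i1 := integrable_mul_exp_neg_mul_sq' hb
  have i2 := integrable_sq_mul_exp_neg_mul_sq hb
  have hd : ∀ s : ℝ, HasDerivAt (fun s => s * Real.exp (-b * s ^ 2))
      (Real.exp (-b * s ^ 2) - 2 * b * (s ^ 2 * Real.exp (-b * s ^ 2))) s := by
    intro s
    have h1 : HasDerivAt (fun s : ℝ => -b * s ^ 2) (-b * (2 * s)) s := by
      simpa using (hasDerivAt_pow 2 s).const_mul (-b)
    refine ((hasDerivAt_id s).fun_mul h1.exp).congr_deriv ?_
    simp only [id]
    ring
  have h := integral_eq_zero_of_hasDerivAt_of_integrable hd (i0.sub (i2.const_mul _)) i1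
  rw [integral_sub i0 (i2.const_mul _), integral_const_mul, integral_gaussian] at h
  rw [eq_div_iff (by positivity)]
  linarith

end GaussianMoments

/-! ### Functions of log |x| in the completion -/

section LogRadial

variable {d : ℕ} {Ψ : ℝ → ℝ}

/-- The function `Ψ(log |x|)`, extended by zero to the origin. -/
def logRadial (d : ℕ) (Ψ : ℝ → ℝ) (x : E d) : ℝ := if x = 0 then 0 else Ψ (Real.log ‖x‖)

/-- The gradient of `logRadial d Ψ`. -/
def logRadialGradient (d : ℕ) (Ψ : ℝ → ℝ) (x : E d) : E d :=
  (deriv Ψ (Real.log ‖x‖) / ‖x‖ ^ 2) • x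

theorem hasFDerivAt_log_norm {x : E d} (hx : x ≠ 0) :
    HasFDerivAt (fun y : E d => Real.log ‖y‖) ((‖x‖ ^ 2)⁻¹ • innerSL ℝ x) x := by
  have h0 : ‖x‖ ≠ 0 := norm_ne_zero_iff.2 hx
  have h1 : HasFDerivAt (fun y : E d => ‖y‖ ^ 2) (2 • innerSL ℝ x) x :=
    (hasStrictFDerivAt_norm_sq x).hasFDerivAt
  have h2 := (h1.log (by positivity)).const_mul (1 / 2)
  -- Valid at y = 0 too, where both logarithms take the default value 0.
  have h3 : (fun y : E d => Real.log ‖y‖) = fun y => 1 / 2 * Real.log (‖y‖ ^ 2) := by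
    ext y
    rw [Real.log_pow]
    push_cast
    ring
  rw [h3]
  refine h2.congr_fderiv ?_
  ext y
  simp
  ring

theorem logRadial_eventuallyEq {x : E d} (hx : x ≠ 0) :
    logRadial d Ψ =ᶠ[𝓝 x] fun y => Ψ (Real.log ‖y‖) := by
  filter_upwards [isOpen_ne.mem_nhds hx] with y hy
  simp [logRadial, show y ≠ 0 from hy]

theorem gradient_logRadial (hΨ : Differentiable ℝ Ψ) {x : E d} (hx : x ≠ 0) :
    gradient (logRadial d Ψ) x = logRadialGradient d Ψ x := by
  refine HasGradientAt.gradient ?_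
  rw [hasGradientAt_iff_hasFDerivAt]
  have h := (hΨ (Real.log ‖x‖)).hasDerivAt.comp_hasFDerivAt x (hasFDerivAt_log_norm hx)
  refine (h.congr_of_eventuallyEq (logRadial_eventuallyEq hx)).congr_fderiv ?_
  ext y
  simp [logRadialGradient, div_eq_mul_inv, mul_assoc]

/-- Compact support in log |x| means support in an annulus, so the function vanishes near the origin
and the conditions for d = 1 and d ≥ 2 both hold. -/
theorem isTestFunction_logRadial (hΨ : ContDiff ℝ ∞ Ψ) (hc : HasCompactSupport Ψ) :
    IsTestFunction (logRadial d Ψ) := by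
  obtain ⟨R, hR0, hR⟩ := hc.isCompact.isBounded.exists_pos_norm_le
  have hsupp : ∀ x : E d, logRadial d Ψ x ≠ 0 → Real.exp (-R) ≤ ‖x‖ ∧ ‖x‖ ≤ Real.exp R := by
    intro x hx
    have hx0 : x ≠ 0 := by
      rintro rfl
      simp [logRadial] at hx
    have hpos : 0 < ‖x‖ := norm_pos_iff.2 hx0
    rw [logRadial, if_neg hx0] at hx
    have h := abs_le.1 (hR _ (subset_tsupport _ hx))
    exact ⟨(Real.le_log_iff_exp_le hpos).1 h.1, (Real.log_le_iff_le_exp hpos).1 h.2⟩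
  have hts : tsupport (logRadial d Ψ) ⊆ {x | Real.exp (-R) ≤ ‖x‖ ∧ ‖x‖ ≤ Real.exp R} :=
    closure_minimal hsupp
      ((isClosed_le continuous_const continuous_norm).inter
        (isClosed_le continuous_norm continuous_const))
  have h0 : (0 : E d) ∉ tsupport (logRadial d Ψ) := by
    intro h
    have := (hts h).1
    rw [norm_zero] at this
    exact absurd (Real.exp_pos _) (not_lt.2 this)
  have hev : logRadial d Ψ =ᶠ[𝓝 0] fun _ => 0 := notMem_tsupport_iff_eventuallyEq.1 h0
  refine ⟨?_, ?_, fun _ => h0, fun _ => ?_⟩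
  · rw [contDiff_iff_contDiffAt]
    intro x
    rcases eq_or_ne x 0 with rfl | hx
    · exact contDiffAt_const.congr_of_eventuallyEq hev
    · refine ContDiffAt.congr_of_eventuallyEq ?_ (logRadial_eventuallyEq hx)
      exact hΨ.contDiffAt.comp x ((contDiffAt_norm ℝ hx).log (norm_ne_zero_iff.2 hx))
  · refine HasCompactSupport.of_support_subset_isCompact (isCompact_closedBall 0 (Real.exp R)) ?_
    intro x hx
    simpa using (hsupp x hx).2
  · rw [hev.gradient_eq]
    simp [gradient]

variable {a : ℝ}

theorem exp_log_mul_rpow {x : E d} (hx : 0 < ‖x‖) (y : ℝ) :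
    y ^ 2 / ‖x‖ ^ (2 * (a + 1)) = ‖x‖ ^ (-(d : ℝ)) *
      (Real.exp (((d : ℝ) - 2 - 2 * a) * Real.log ‖x‖) * y ^ 2) := by
  rw [exp_mul_log_eq_rpow hx, ← mul_assoc, ← Real.rpow_add hx, div_eq_mul_inv,
    ← Real.rpow_neg hx.le, mul_comm]
  congr 2
  ring

theorem norm_sub_logRadialGradient_sq {Ψ₁ Ψ₂ : ℝ → ℝ} {x : E d} (hx : 0 < ‖x‖) :
    ‖logRadialGradient d Ψ₁ x - logRadialGradient d Ψ₂ x‖ ^ 2 / ‖x‖ ^ (2 * a) =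
      ‖x‖ ^ (-(d : ℝ)) * (Real.exp (((d : ℝ) - 2 - 2 * a) * Real.log ‖x‖) *
        (deriv Ψ₁ (Real.log ‖x‖) - deriv Ψ₂ (Real.log ‖x‖)) ^ 2) := by
  rw [← exp_log_mul_rpow hx, logRadialGradient, logRadialGradient, ← sub_smul, norm_smul, mul_pow,
    Real.norm_eq_abs, sq_abs, ← sub_div, mul_add, mul_one, Real.rpow_add hx, Real.rpow_ofNat]
  field_simp

theorem norm_logRadialGradient_sq {x : E d} (hx : 0 < ‖x‖) :
    ‖logRadialGradient d Ψ x‖ ^ 2 / ‖x‖ ^ (2 * a) =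
      ‖x‖ ^ (-(d : ℝ)) * (Real.exp (((d : ℝ) - 2 - 2 * a) * Real.log ‖x‖) *
        deriv Ψ (Real.log ‖x‖) ^ 2) := by
  have h := norm_sub_logRadialGradient_sq (d := d) (a := a) (Ψ₁ := Ψ) (Ψ₂ := fun _ => 0) hx
  have h0 : logRadialGradient d (fun _ => 0) x = 0 := by simp [logRadialGradient]
  rw [h0, sub_zero] at h
  simpa using h

theorem measurable_logRadialGradient : Measurable (logRadialGradient d Ψ) := by
  unfold logRadialGradient
  have : Measurable (deriv Ψ) := measurable_deriv Ψ
  fun_prop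

theorem measurable_logRadial (hΨ : Measurable Ψ) : Measurable (logRadial d Ψ) :=
  Measurable.ite (measurableSet_singleton 0) measurable_const (by fun_prop)

/-- Smooth functions of `log |x|` with finite weighted norms belong to the completion, by cutting
off in the variable `log |x|`. -/
theorem hasWeightedGradient_logRadial (hd : 1 ≤ d) (hΨ : ContDiff ℝ ∞ Ψ)
    (h0 : Integrable fun s => Real.exp (((d : ℝ) - 2 - 2 * a) * s) * Ψ s ^ 2)
    (h1 : Integrable fun s => Real.exp (((d : ℝ) - 2 - 2 * a) * s) * deriv Ψ s ^ 2) :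
    HasWeightedGradient a (logRadial d Ψ) (logRadialGradient d Ψ) := by
  refine ⟨(measurable_logRadial hΨ.continuous.measurable).aestronglyMeasurable,
    measurable_logRadialGradient.aestronglyMeasurable, ?_⟩
  set c := (d : ℝ) - 2 - 2 * a with hc
  -- The cutoffs χ(s/(n+1)) have derivatives bounded by B/(n+1) ≤ B, so both weighted errors are
  -- dominated by the integrable functions of `h0` and `h1`.
  let χ : ContDiffBump (0 : ℝ) := ⟨1, 2, one_pos, one_lt_two⟩
  have hχ : ContDiff ℝ ∞ χ := χ.contDiff
  have hχd : ∀ s, HasDerivAt χ (deriv χ s) s := fun s =>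
    (hχ.differentiable (by simp) s).hasDerivAt
  have hΨd : ∀ s, HasDerivAt Ψ (deriv Ψ s) s := fun s =>
    (hΨ.differentiable (by simp) s).hasDerivAt
  have hχ'c : Continuous (deriv χ) := hχ.continuous_deriv (by simp)
  have hΨ'c : Continuous (deriv Ψ) := hΨ.continuous_deriv (by simp)
  have hχcs : HasCompactSupport χ := χ.hasCompactSupport
  obtain ⟨B, hB⟩ := hχcs.deriv.exists_bound_of_continuous hχ'c
  let Ψn : ℕ → ℝ → ℝ := fun n s => χ (s / (n + 1)) * Ψ s
  have hn0 : ∀ n : ℕ, (0 : ℝ) < n + 1 := fun n => by positivity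
  have hΨn : ∀ n, ContDiff ℝ ∞ (Ψn n) := fun n =>
    (hχ.comp (contDiff_id.div_const _)).mul hΨ
  have hΨnd : ∀ n s, HasDerivAt (Ψn n)
      (deriv χ (s / (n + 1)) / (n + 1) * Ψ s + χ (s / (n + 1)) * deriv Ψ s) s := fun n s => by
    have h := (hχd (s / (n + 1))).comp s ((hasDerivAt_id s).div_const ((n : ℝ) + 1))
    exact (h.mul (hΨd s)).congr_deriv (by simp only [Function.comp_apply, id]; ring)
  have hΨncs : ∀ n, HasCompactSupport (Ψn n) := fun n => by
    refine HasCompactSupport.mul_right ?_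
    have h := hχcs.comp_homeomorph (Homeomorph.mulRight₀ ((n : ℝ) + 1)⁻¹ (inv_ne_zero (hn0 n).ne'))
    simpa [Function.comp_def, div_eq_mul_inv] using h
  -- Equality on a whole neighbourhood of s gives pointwise convergence of the derivatives as well
  -- as of the functions.
  have hone : ∀ s : ℝ, ∀ᶠ n : ℕ in atTop, Ψn n =ᶠ[𝓝 s] Ψ := by
    intro s
    obtain ⟨N, hN⟩ := exists_nat_gt |s|
    filter_upwards [eventually_ge_atTop N] with n hn
    have hs : |s| < n + 1 := by
      have : (N : ℝ) ≤ n := by exact_mod_cast hn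
      linarith
    filter_upwards [(isOpen_lt continuous_abs continuous_const).mem_nhds hs] with t ht
    have : χ (t / (n + 1)) = 1 := by
      refine χ.one_of_mem_closedBall ?_
      rw [mem_closedBall_zero_iff, norm_div, Real.norm_eq_abs, Real.norm_of_nonneg (hn0 n).le]
      exact (div_le_one (hn0 n)).2 (le_of_lt ht)
    simp [Ψn, this]
  have hχle : ∀ t, |χ t - 1| ≤ 1 := fun t => by
    rw [abs_le]
    constructor <;> linarith [χ.nonneg (x := t), χ.le_one (x := t)]
  refine ⟨fun n => logRadial d (Ψn n), fun n => isTestFunction_logRadial (hΨn n) (hΨncs n),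
    ?_, ?_⟩
  · have heq : ∀ n, ∫⁻ x : E d, ENNReal.ofReal (‖gradient (logRadial d (Ψn n)) x
        - logRadialGradient d Ψ x‖ ^ 2 / ‖x‖ ^ (2 * a)) =
        ∫⁻ s, ENNReal.ofReal (sphereArea d *
          (Real.exp (c * s) * (deriv (Ψn n) s - deriv Ψ s) ^ 2)) := by
      intro n
      have : Continuous (deriv (Ψn n)) := (hΨn n).continuous_deriv (by simp)
      refine lintegral_ofReal_radial
        (k := fun s => Real.exp (c * s) * (deriv (Ψn n) s - deriv Ψ s) ^ 2) hd (by fun_prop) ?_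
      filter_upwards [norm_ne_zero_ae hd] with x hx
      rw [gradient_logRadial ((hΨn n).differentiable (by simp)) (norm_pos_iff.1 hx),
        norm_sub_logRadialGradient_sq hx]
    simp only [heq]
    have hb : Integrable fun s => sphereArea d * (2 * B ^ 2 * (Real.exp (c * s) * Ψ s ^ 2) +
        2 * (Real.exp (c * s) * deriv Ψ s ^ 2)) :=
      ((h0.const_mul _).add (h1.const_mul _)).const_mul _
    have := tendsto_lintegral_of_dominated_convergence (μ := volume)
      (F := fun n s => ENNReal.ofReal (sphereArea d *
          (Real.exp (c * s) * (deriv (Ψn n) s - deriv Ψ s) ^ 2))) (f := fun _ => 0)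
      (fun s => ENNReal.ofReal (sphereArea d * (2 * B ^ 2 * (Real.exp (c * s) * Ψ s ^ 2) +
        2 * (Real.exp (c * s) * deriv Ψ s ^ 2)))) (fun n => by
        have : Continuous (deriv (Ψn n)) := (hΨn n).continuous_deriv (by simp)
        fun_prop) (fun n => Eventually.of_forall fun s => by
        refine ENNReal.ofReal_le_ofReal (mul_le_mul_of_nonneg_left ?_ (sphereArea_pos hd).le)
        rw [(hΨnd n s).deriv]
        have hsq : (deriv χ (s / (n + 1)) / (n + 1) * Ψ s + χ (s / (n + 1)) * deriv Ψ s
            - deriv Ψ s) ^ 2 ≤ 2 * B ^ 2 * Ψ s ^ 2 + 2 * deriv Ψ s ^ 2 := by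
          have hq : |deriv χ (s / (n + 1)) / (n + 1)| ≤ B := by
            rw [abs_div, abs_of_pos (hn0 n)]
            exact (div_le_self (abs_nonneg _) (by simp)).trans (hB _)
          have e1 : (deriv χ (s / (n + 1)) / (n + 1) * Ψ s) ^ 2 ≤ B ^ 2 * Ψ s ^ 2 := by
            rw [mul_pow]
            exact mul_le_mul_of_nonneg_right
              (sq_le_sq' (neg_le_of_abs_le hq) (le_of_abs_le hq)) (sq_nonneg _)
          have e2 : ((χ (s / (n + 1)) - 1) * deriv Ψ s) ^ 2 ≤ 1 * deriv Ψ s ^ 2 := by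
            rw [mul_pow]
            refine mul_le_mul_of_nonneg_right ?_ (sq_nonneg _)
            rw [sq_le_one_iff_abs_le_one]
            exact hχle _
          nlinarith [sq_nonneg (deriv χ (s / (n + 1)) / (n + 1) * Ψ s -
            (χ (s / (n + 1)) - 1) * deriv Ψ s)]
        have := mul_le_mul_of_nonneg_left hsq (Real.exp_pos (c * s)).le
        linarith) hb.lintegral_lt_top.ne
      (Eventually.of_forall fun s => tendsto_const_nhds.congr' (by
        filter_upwards [hone s] with n hn
        rw [hn.deriv_eq]
        simp))
    simpa using this
  · have heq : ∀ n, ∫⁻ x : E d, ENNReal.ofReal ((logRadial d (Ψn n) x - logRadial d Ψ x) ^ 2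
        / ‖x‖ ^ (2 * (a + 1))) = ∫⁻ s, ENNReal.ofReal (sphereArea d *
          (Real.exp (c * s) * (Ψn n s - Ψ s) ^ 2)) := by
      intro n
      have h1 := (hΨn n).continuous
      have h2 := hΨ.continuous
      refine lintegral_ofReal_radial
        (k := fun s => Real.exp (c * s) * (Ψn n s - Ψ s) ^ 2) hd (by fun_prop) ?_
      filter_upwards [norm_ne_zero_ae hd] with x hx
      rw [exp_log_mul_rpow hx, logRadial, logRadial, if_neg (norm_pos_iff.1 hx),
        if_neg (norm_pos_iff.1 hx)]
    simp only [heq]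
    have hb := h0.const_mul (sphereArea d)
    have := tendsto_lintegral_of_dominated_convergence (μ := volume)
      (F := fun n s => ENNReal.ofReal (sphereArea d *
          (Real.exp (c * s) * (Ψn n s - Ψ s) ^ 2))) (f := fun _ => 0)
      (fun s => ENNReal.ofReal (sphereArea d * (Real.exp (c * s) * Ψ s ^ 2))) (fun n => by
        have h1 := (hΨn n).continuous
        have h2 := hΨ.continuous
        fun_prop) (fun n => Eventually.of_forall fun s => by
        refine ENNReal.ofReal_le_ofReal (mul_le_mul_of_nonneg_left
          (mul_le_mul_of_nonneg_left ?_ (Real.exp_pos _).le) (sphereArea_pos hd).le)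
        have : Ψn n s - Ψ s = (χ (s / (n + 1)) - 1) * Ψ s := by
          simp only [Ψn]
          ring
        rw [this, mul_pow]
        refine mul_le_of_le_one_left (sq_nonneg _) ?_
        rw [sq_le_one_iff_abs_le_one]
        exact hχle _) hb.lintegral_lt_top.ne
      (Eventually.of_forall fun s => tendsto_const_nhds.congr' (by
        filter_upwards [hone s] with n hn
        rw [hn.self_of_nhds]
        simp))
    simpa using this

theorem dirichletEnergy_logRadialGradient (hd : 1 ≤ d) :
    dirichletEnergy a (logRadialGradient d Ψ) = sphereArea d *
      ∫ s, Real.exp (((d : ℝ) - 2 - 2 * a) * s) * deriv Ψ s ^ 2 := by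
  have hS := (sphereArea_pos hd).le
  have hm := measurable_logRadialGradient (d := d) (Ψ := Ψ)
  have hΨ := measurable_deriv Ψ
  rw [dirichletEnergy, integral_eq_lintegral_of_nonneg_ae (Eventually.of_forall fun x => by
    simp only [Pi.zero_apply]; positivity) (Measurable.aestronglyMeasurable (by fun_prop)),
    lintegral_ofReal_radial (k := fun s => Real.exp (((d : ℝ) - 2 - 2 * a) * s) * deriv Ψ s ^ 2)
      hd (by fun_prop), ← integral_const_mul,
    integral_eq_lintegral_of_nonneg_ae (Eventually.of_forall fun x => by
      simp only [Pi.zero_apply]; positivity) (Measurable.aestronglyMeasurable (by fun_prop))]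
  filter_upwards [norm_ne_zero_ae hd] with x hx
  exact norm_logRadialGradient_sq hx

end LogRadial

/-! ### Gaussian profiles and equality -/

section Extremal

variable {d : ℕ} {a κ A : ℝ}

/-- The profile, in the variable `log |x|`, of a function whose transform is `A exp (-κ s²)`. -/
def gaussianProfile (d : ℕ) (a κ A : ℝ) (s : ℝ) : ℝ :=
  A * Real.exp (-(((d : ℝ) - 2 - 2 * a) / 2) * s - κ * s ^ 2)

theorem hasDerivAt_gaussianProfile (s : ℝ) : HasDerivAt (gaussianProfile d a κ A)
    (-((((d : ℝ) - 2 - 2 * a) / 2) + 2 * κ * s) * gaussianProfile d a κ A s) s := by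
  have h1 : HasDerivAt (fun s : ℝ => -(((d : ℝ) - 2 - 2 * a) / 2) * s - κ * s ^ 2)
      (-(((d : ℝ) - 2 - 2 * a) / 2) * 1 - κ * (2 * s)) s := by
    simpa using ((hasDerivAt_id s).const_mul (-(((d : ℝ) - 2 - 2 * a) / 2))).fun_sub
      ((hasDerivAt_pow 2 s).const_mul κ)
  refine (h1.exp.const_mul A).congr_deriv ?_
  rw [gaussianProfile]
  ring

theorem exp_mul_gaussianProfile_sq (s : ℝ) :
    Real.exp (((d : ℝ) - 2 - 2 * a) * s) * gaussianProfile d a κ A s ^ 2 =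
      A ^ 2 * Real.exp (-(2 * κ) * s ^ 2) := by
  rw [gaussianProfile, mul_pow, ← Real.exp_nat_mul, mul_left_comm, ← Real.exp_add]
  congr 2
  push_cast
  ring

theorem exp_mul_deriv_gaussianProfile_sq (s : ℝ) :
    Real.exp (((d : ℝ) - 2 - 2 * a) * s) * deriv (gaussianProfile d a κ A) s ^ 2 =
      A ^ 2 * ((((d : ℝ) - 2 - 2 * a) / 2) ^ 2 * Real.exp (-(2 * κ) * s ^ 2) +
        2 * ((d : ℝ) - 2 - 2 * a) * κ * (s * Real.exp (-(2 * κ) * s ^ 2)) +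
        4 * κ ^ 2 * (s ^ 2 * Real.exp (-(2 * κ) * s ^ 2))) := by
  rw [(hasDerivAt_gaussianProfile s).deriv, mul_pow, mul_left_comm, exp_mul_gaussianProfile_sq]
  ring

theorem integrable_exp_mul_deriv_gaussianProfile_sq (hκ : 0 < κ) :
    Integrable fun s => (((d : ℝ) - 2 - 2 * a) / 2) ^ 2 * Real.exp (-(2 * κ) * s ^ 2) +
        2 * ((d : ℝ) - 2 - 2 * a) * κ * (s * Real.exp (-(2 * κ) * s ^ 2)) := by
  have hb : 0 < 2 * κ := by positivity
  exact ((integrable_exp_neg_mul_sq hb).const_mul _).add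
    ((integrable_mul_exp_neg_mul_sq' hb).const_mul _)

theorem hasWeightedGradient_gaussian (hd : 1 ≤ d) (hκ : 0 < κ) :
    HasWeightedGradient a (logRadial d (gaussianProfile d a κ A))
      (logRadialGradient d (gaussianProfile d a κ A)) := by
  have hb : 0 < 2 * κ := by positivity
  have hs : ContDiff ℝ ∞ (gaussianProfile d a κ A) := by
    unfold gaussianProfile
    fun_prop
  refine hasWeightedGradient_logRadial hd hs ?_ ?_
  · simp only [exp_mul_gaussianProfile_sq]
    exact (integrable_exp_neg_mul_sq hb).const_mul _
  · simp only [exp_mul_deriv_gaussianProfile_sq]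
    exact ((integrable_exp_mul_deriv_gaussianProfile_sq hκ).add
      ((integrable_sq_mul_exp_neg_mul_sq hb).const_mul _)).const_mul _

theorem hasProfile_gaussian (hd : 1 ≤ d) :
    HasProfile a (logRadial d (gaussianProfile d a κ A)) fun s => A * Real.exp (-κ * s ^ 2) := by
  filter_upwards [norm_ne_zero_ae hd] with x hx
  rw [logRadial, if_neg (norm_pos_iff.1 hx), gaussianProfile, mul_left_comm, ← Real.exp_add]
  ring_nf

theorem gaussian_sq (s : ℝ) :
    (A * Real.exp (-κ * s ^ 2)) ^ 2 = A ^ 2 * Real.exp (-(2 * κ) * s ^ 2) := by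
  rw [mul_pow, ← Real.exp_nat_mul]
  congr 2
  push_cast
  ring

theorem weightedMass_gaussian (hd : 1 ≤ d) :
    weightedMass a (logRadial d (gaussianProfile d a κ A)) =
      sphereArea d * (A ^ 2 * √(Real.pi / (2 * κ))) := by
  rw [(hasProfile_gaussian hd).weightedMass_eq hd (by fun_prop)]
  simp only [gaussian_sq]
  rw [integral_const_mul, integral_gaussian]

theorem dirichletEnergy_gaussian (hd : 1 ≤ d) (hκ : 0 < κ) :
    dirichletEnergy a (logRadialGradient d (gaussianProfile d a κ A)) =
      sphereArea d * (A ^ 2 * √(Real.pi / (2 * κ))) *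
        ((((d : ℝ) - 2 - 2 * a) / 2) ^ 2 + κ) := by
  have hb : 0 < 2 * κ := by positivity
  rw [dirichletEnergy_logRadialGradient hd]
  simp only [exp_mul_deriv_gaussianProfile_sq]
  rw [integral_const_mul, integral_add (integrable_exp_mul_deriv_gaussianProfile_sq hκ)
    ((integrable_sq_mul_exp_neg_mul_sq hb).const_mul _),
    integral_add ((integrable_exp_neg_mul_sq hb).const_mul _)
      ((integrable_mul_exp_neg_mul_sq' hb).const_mul _),
    integral_const_mul, integral_const_mul, integral_const_mul, integral_gaussian,
    integral_mul_exp_neg_mul_sq, integral_sq_mul_exp_neg_mul_sq hb]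
  field_simp
  ring

theorem extIntegral_logDensity_gaussian (hd : 1 ≤ d) (hκ : 0 < κ)
    (hA : sphereArea d * (A ^ 2 * √(Real.pi / (2 * κ))) = 1) :
    extIntegral (logDensity a (logRadial d (gaussianProfile d a κ A))) =
      (((Real.log 2 + Real.log κ - Real.log Real.pi) / 2 - Real.log (sphereArea d) - 1 / 2 : ℝ) :
        EReal) := by
  have hb : 0 < 2 * κ := by positivity
  have hS := sphereArea_pos hd
  have hprof := hasProfile_gaussian (a := a) (κ := κ) (A := A) hd
  have hA2 : 0 < A ^ 2 := by
    refine lt_of_le_of_ne (sq_nonneg A) fun h => ?_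
    rw [← h] at hA
    simp at hA
  have hlogA : Real.log (A ^ 2) =
      (Real.log 2 + Real.log κ - Real.log Real.pi) / 2 - Real.log (sphereArea d) := by
    have h := congrArg Real.log hA
    rw [Real.log_mul hS.ne' (by positivity), Real.log_mul hA2.ne' (by positivity),
      Real.log_sqrt (by positivity), Real.log_div (by positivity) hb.ne',
      Real.log_mul (by norm_num) hκ.ne', Real.log_one] at h
    linarith
  have hk : ∀ s : ℝ, sphereArea d * ((A * Real.exp (-κ * s ^ 2)) ^ 2 *
      Real.log ((A * Real.exp (-κ * s ^ 2)) ^ 2)) =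
      sphereArea d * A ^ 2 * (Real.log (A ^ 2) * Real.exp (-(2 * κ) * s ^ 2) -
        2 * κ * (s ^ 2 * Real.exp (-(2 * κ) * s ^ 2))) := by
    intro s
    rw [gaussian_sq, Real.log_mul hA2.ne' (Real.exp_pos _).ne', Real.log_exp]
    ring
  have i0 := (integrable_exp_neg_mul_sq hb).const_mul (Real.log (A ^ 2))
  have i2 := (integrable_sq_mul_exp_neg_mul_sq hb).const_mul (2 * κ)
  have hi : Integrable fun s => sphereArea d * ((A * Real.exp (-κ * s ^ 2)) ^ 2 *
      Real.log ((A * Real.exp (-κ * s ^ 2)) ^ 2)) := by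
    simp only [hk]
    exact (i0.sub i2).const_mul _
  rw [extIntegral, hprof.lintegral_logDensity hd (by fun_prop),
    hprof.lintegral_neg_logDensity hd (by fun_prop), lintegral_sub_lintegral_eq_integral hi,
    EReal.coe_eq_coe_iff]
  simp only [hk]
  rw [integral_const_mul, integral_sub i0 i2, integral_const_mul, integral_const_mul,
    integral_gaussian, integral_sq_mul_exp_neg_mul_sq hb, ← hlogA]
  have h4 : 2 * κ * (√(Real.pi / (2 * κ)) / (2 * (2 * κ))) = √(Real.pi / (2 * κ)) / 2 := by
    field_simp
  rw [h4]
  linear_combination (Real.log (A ^ 2) - 1 / 2) * hA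

theorem extremalProfile_eq (ha : a < ((d : ℝ) - 2) / 2) (γ : ℝ) :
    extremalProfile d a γ =
      logRadial d (gaussianProfile d a (((d : ℝ) - 2 - 2 * a) ^ 2 / (4 * (4 * γ - 1))) 1) := by
  have hc : 0 < (d : ℝ) - 2 - 2 * a := by linarith
  ext x
  rcases eq_or_ne x 0 with rfl | hx
  -- At the origin, 0 raised to a nonzero real power is 0 by convention, matching the value assigned
  -- by `logRadial`.
  · have : -(((d : ℝ) - 2 - 2 * a) / 2) ≠ 0 := by linarith
    rw [extremalProfile, norm_zero, Real.zero_rpow this, zero_mul]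
    simp [logRadial]
  · rw [extremalProfile, logRadial, if_neg hx, gaussianProfile,
      ← exp_mul_log_eq_rpow (norm_pos_iff.2 hx), ← Real.exp_add, one_mul]
    ring_nf

theorem extremal_eq (ha : a < ((d : ℝ) - 2) / 2) (γ : ℝ) :
    extremal d a γ =
      logRadial d (gaussianProfile d a (((d : ℝ) - 2 - 2 * a) ^ 2 / (4 * (4 * γ - 1)))
        (√(weightedMass a (extremalProfile d a γ)))⁻¹) := by
  ext x
  rw [extremal, extremalProfile_eq ha]
  rcases eq_or_ne x 0 with rfl | hx
  · simp [logRadial]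
  · simp only [logRadial, if_neg hx, gaussianProfile]
    ring

theorem isRadial_logRadial {Ψ : ℝ → ℝ} (hΨ : Measurable Ψ) : IsRadial (logRadial d Ψ) := by
  refine ⟨fun r => if r = 0 then 0 else Ψ (Real.log r),
    Measurable.ite (measurableSet_singleton 0) measurable_const (by fun_prop),
    Eventually.of_forall fun x => ?_⟩
  simp [logRadial, norm_eq_zero]

/-- The mass, energy and entropy of the normalized extremal function with parameter `γ`. -/
theorem extremal_properties (hd : 1 ≤ d) (ha : a < ((d : ℝ) - 2) / 2) {γ : ℝ} (hγ : 1 / 4 < γ)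
    (hκ : κ = ((d : ℝ) - 2 - 2 * a) ^ 2 / (4 * (4 * γ - 1))) :
    IsRadial (extremal d a γ) ∧ weightedMass a (extremal d a γ) = 1 ∧
      ∃ G, HasWeightedGradient a (extremal d a γ) G ∧
        dirichletEnergy a G = (((d : ℝ) - 2 - 2 * a) / 2) ^ 2 + κ ∧
        extIntegral (logDensity a (extremal d a γ)) =
          (((Real.log 2 + Real.log κ - Real.log Real.pi) / 2 - Real.log (sphereArea d) - 1 / 2
            : ℝ) : EReal) := by
  have hc : 0 < (d : ℝ) - 2 - 2 * a := by linarith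
  have hγ1 : 0 < 4 * γ - 1 := by linarith
  have hκ0 : 0 < κ := by rw [hκ]; positivity
  have hS := sphereArea_pos hd
  set A := (√(weightedMass a (extremalProfile d a γ)))⁻¹ with hAdef
  have hA : sphereArea d * (A ^ 2 * √(Real.pi / (2 * κ))) = 1 := by
    have hm : weightedMass a (extremalProfile d a γ) = sphereArea d * √(Real.pi / (2 * κ)) := by
      rw [extremalProfile_eq ha, ← hκ, weightedMass_gaussian hd, one_pow, one_mul]
    rw [hAdef, hm, inv_pow, Real.sq_sqrt (by positivity)]
    field_simp
  rw [extremal_eq ha, ← hκ, ← hAdef]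
  refine ⟨isRadial_logRadial ?_, ?_, _, hasWeightedGradient_gaussian hd hκ0, ?_,
    extIntegral_logDensity_gaussian hd hκ0 hA⟩
  · unfold gaussianProfile
    fun_prop
  · rw [weightedMass_gaussian hd, hA]
  · rw [dirichletEnergy_gaussian hd hκ0, hA, one_mul]

/-- Gaussians saturate the logarithmic Sobolev inequality for every κ; this κ makes the energy
(c/2)² + κ equal to γc²/(4γ-1), where the tangent-line bound of `entropy_bound_le_log` is also an
equality. -/
theorem extremal_equality (hd : 1 ≤ d) (ha : a < ((d : ℝ) - 2) / 2) {γ : ℝ} (hγ : 1 / 4 < γ)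
    (hκ : κ = ((d : ℝ) - 2 - 2 * a) ^ 2 / (4 * (4 * γ - 1))) :
    (Real.log 2 + Real.log κ - Real.log Real.pi) / 2 - Real.log (sphereArea d) - 1 / 2 =
      2 * γ * Real.log (logHardyConst d a γ * ((((d : ℝ) - 2 - 2 * a) / 2) ^ 2 + κ)) := by
  have hc : 0 < (d : ℝ) - 2 - 2 * a := by linarith
  have hγ1 : 0 < 4 * γ - 1 := by linarith
  have hγ0 : 0 < γ := by linarith
  have hK : (((d : ℝ) - 2 - 2 * a) / 2) ^ 2 + κ =
      γ / ((4 * γ - 1) / ((d : ℝ) - 2 - 2 * a) ^ 2) := by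
    rw [hκ]
    field_simp
    ring
  have hlogκ : Real.log κ = -(2 * Real.log 2) -
      Real.log ((4 * γ - 1) / ((d : ℝ) - 2 - 2 * a) ^ 2) := by
    have : κ = ((2 : ℝ) ^ 2)⁻¹ / ((4 * γ - 1) / ((d : ℝ) - 2 - 2 * a) ^ 2) := by
      rw [hκ]
      field_simp
      norm_num
    rw [this, Real.log_div (by positivity) (by positivity), Real.log_inv, Real.log_pow]
    push_cast
    ring
  rw [hK, Real.log_mul (logHardyConst_pos hd ha hγ.le).ne' (by positivity), mul_add,
    two_mul_log_logHardyConst hd ha hγ.le, Real.log_div hγ0.ne' (by positivity), hlogκ,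
    log_sphereArea hd]
  ring

end Extremal

/-! ### Sharpness of the constant -/

/-- For γ > 1/4, test with the extremal function. For γ = 1/4, test with the extremals of all γ' >
1/4: these realize every κ > 0, and as κ → ∞ the Hardy term (c/2)² becomes negligible beside κ. -/
theorem logHardyConst_le_of_bound {d : ℕ} (hd : 1 ≤ d) {a γ : ℝ} (ha : a < ((d : ℝ) - 2) / 2)
    (hγ : 1 / 4 ≤ γ) {C : ℝ} (hC : 0 < C)
    (h : ∀ (u : E d → ℝ) (G : E d → E d), HasWeightedGradient a u G → IsRadial u →
      weightedMass a u = 1 → extIntegral (logDensity a u) ≤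
        ((2 * γ * Real.log (C * dirichletEnergy a G) : ℝ) : EReal)) :
    logHardyConst d a γ ≤ C := by
  have hc : 0 < (d : ℝ) - 2 - 2 * a := by linarith
  have hC0 := logHardyConst_pos hd ha hγ
  have hbound : ∀ {γ' κ : ℝ}, 1 / 4 < γ' →
      κ = ((d : ℝ) - 2 - 2 * a) ^ 2 / (4 * (4 * γ' - 1)) →
      (Real.log 2 + Real.log κ - Real.log Real.pi) / 2 - Real.log (sphereArea d) - 1 / 2 ≤
        2 * γ * Real.log (C * ((((d : ℝ) - 2 - 2 * a) / 2) ^ 2 + κ)) := by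
    intro γ' κ hγ' hκ
    obtain ⟨h1, h2, G, h3, h4, h5⟩ := extremal_properties hd ha hγ' hκ
    have := h _ G h3 h1 h2
    rwa [h4, h5, EReal.coe_le_coe_iff] at this
  rcases hγ.eq_or_lt with h4 | h4
  · have hκ : ∀ κ : ℝ, 0 < κ →
        logHardyConst d a γ * κ ≤ C * ((((d : ℝ) - 2 - 2 * a) / 2) ^ 2 + κ) := by
      intro κ hκ
      -- This γ' solves κ = c²/(4(4γ'-1)) for the prescribed κ.
      have hb := hbound (γ' := (1 + ((d : ℝ) - 2 - 2 * a) ^ 2 / (4 * κ)) / 4) (κ := κ) (by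
        have : 0 < ((d : ℝ) - 2 - 2 * a) ^ 2 / (4 * κ) := by positivity
        linarith) (by field_simp; ring)
      have hl := two_mul_log_logHardyConst hd ha hγ
      rw [← Real.log_le_log_iff (by positivity) (by positivity), Real.log_mul hC0.ne' hκ.ne']
      rw [log_sphereArea hd] at hb
      rw [← h4, Real.log_div one_ne_zero (by norm_num), Real.log_one,
        show (4 : ℝ) = 2 ^ 2 by norm_num, Real.log_pow] at hl
      rw [← h4] at hb ⊢
      norm_num at hl
      linarith
    refine le_of_forall_pos_le_add fun ε hε => ?_
    -- This κ makes the lower-order term C(c/2)² equal to εκ, so that division by κ leaves C + ε.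
    have := hκ (C * (((d : ℝ) - 2 - 2 * a) / 2) ^ 2 / ε) (by positivity)
    set m := C * (((d : ℝ) - 2 - 2 * a) / 2) ^ 2 with hm
    have hm0 : 0 < m := by positivity
    rw [mul_add, ← hm] at this
    have he : m = ε * (m / ε) := by field_simp
    have hle : logHardyConst d a γ * (m / ε) ≤ (C + ε) * (m / ε) := by linarith
    exact le_of_mul_le_mul_right hle (by positivity)
  · have hb := hbound h4 rfl
    have hκ0 : 0 < ((d : ℝ) - 2 - 2 * a) ^ 2 / (4 * (4 * γ - 1)) := by
      have : 0 < 4 * γ - 1 := by linarith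
      positivity
    rw [extremal_equality hd ha h4 rfl] at hb
    have := le_of_mul_le_mul_left hb (by linarith)
    rw [Real.log_le_log_iff (by positivity) (by positivity)] at this
    exact le_of_mul_le_mul_right this (by positivity)

end LogHardy

end

theorem theoremB (d : ℕ) (hd : 1 ≤ d) (a γ : ℝ) (ha : a < ((d : ℝ) - 2) / 2)
    (hγ : 1 / 4 ≤ γ) :
    -- the inequality, whose left-hand side is well defined in `[-∞, ∞)`
    (∀ (u : LogHardy.E d → ℝ) (G : LogHardy.E d → LogHardy.E d),
      LogHardy.HasWeightedGradient a u G → LogHardy.IsRadial u →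
      LogHardy.weightedMass a u = 1 →
        (∫⁻ x, ENNReal.ofReal (LogHardy.logDensity a u x)) < ⊤ ∧
        LogHardy.extIntegral (LogHardy.logDensity a u) ≤
          ((2 * γ * Real.log
            (LogHardy.logHardyConst d a γ * LogHardy.dirichletEnergy a G) : ℝ) : EReal)) ∧
    -- the constant is sharp
    (∀ C : ℝ, 0 < C →
      (∀ (u : LogHardy.E d → ℝ) (G : LogHardy.E d → LogHardy.E d),
        LogHardy.HasWeightedGradient a u G → LogHardy.IsRadial u →
        LogHardy.weightedMass a u = 1 →
          LogHardy.extIntegral (LogHardy.logDensity a u) ≤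
            ((2 * γ * Real.log (C * LogHardy.dirichletEnergy a G) : ℝ) : EReal)) →
      LogHardy.logHardyConst d a γ ≤ C) ∧
    -- equality is attained for `γ > 1/4`
    (1 / 4 < γ →
      LogHardy.IsRadial (LogHardy.extremal d a γ) ∧
      LogHardy.weightedMass a (LogHardy.extremal d a γ) = 1 ∧
      ∃ G : LogHardy.E d → LogHardy.E d,
        LogHardy.HasWeightedGradient a (LogHardy.extremal d a γ) G ∧
        LogHardy.extIntegral (LogHardy.logDensity a (LogHardy.extremal d a γ)) =
          ((2 * γ * Real.log
            (LogHardy.logHardyConst d a γ * LogHardy.dirichletEnergy a G) : ℝ) : EReal)) := by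

  refine ⟨fun u G H hr hm => H.log_hardy hd ha hγ hr hm,
    fun C hC h => LogHardy.logHardyConst_le_of_bound hd ha hγ hC h, fun h4 => ?_⟩
  obtain ⟨h1, h2, G, h3, h5, h6⟩ := LogHardy.extremal_properties hd ha h4 rfl
  refine ⟨h1, h2, G, h3, ?_⟩
  rw [h5, h6, LogHardy.extremal_equality hd ha h4 rfl]
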